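/- Let $m\ge 0$ be an integer. Consider the pencil $L$ given by $$\ell_\rho(Y)=Y''+(\rho^2 I+2i\rho Q_1(x)+Q_0(x))Y,\quad x>0,\qquad U_\rho(Y)=Y'(0)+(i\rho h_1+h_0)Y(0),$$ where $Q_0,Q_1$ are functions on $[0,\infty)$ with values in $\mathbb{C}^{m\times m}$, $h_0,h_1\in\mathbb{C}^{m\times m}$, $I$ is the unit matrix and $\rho\in\mathbb{C}$. We say that $L\in\mathcal V$ if the entries of $Q_1$ are absolutely continuous on $[0,T]$ for each $T>0$ and the entries of $Q_0,Q_1,Q_1'$ belong to $L^1(0,\infty)$. Solutions $Y$ of $\ell_\rho(Y)=0$ are understood as usual: $Y'$ exists on $[0,\infty)$ and is absolutely continuous on each $[0,T]$, and the equation holds for almost every $x>0$. For $\rho\in\mathbb{C}\setminus\mathbb{R}$, a Weyl solution is an $m\times m$ matrix solution $\Phi(\cdot,\rho)$ of $\ell_\rho(\Phi)=0$ with $U_\rho(\Phi)=I$ and, as $x\to\infty$, $\Phi(x,\rho)=O(\exp(i\rho x))$ if $\operatorname{Im}\rho>0$ and $\Phi(x,\rho)=O(\exp(-i\rho x))$ if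 $\operatorname{Im}\rho<0$. The Weyl matrix is $M(\rho)=\Phi(0,\rho)$, for those $\rho\in\mathbb{C}\setminus\mathbb{R}$ for which a Weyl solution exists. **Theorem.** Let $L$ and $\tilde L$ be two pencils of the same size $m$ in the class $\mathcal V$, with coefficients $Q_0,Q_1,h_0,h_1$ and $\tilde Q_0,\tilde Q_1,\tilde h_0,\tilde h_1$, such that $\det(I\pm h_1)\ne0$ and $\det(I\pm\tilde h_1)\neq 0$. If $M(\rho)=\tilde M(\rho)$ for every $\rho\in\mathbb{C}\setminus\mathbb{R}$ at which both Weyl matrices are defined, then $L=\tilde L$, that is, $Q_1(x)=\tilde Q_1(x)$ for all $x\ge0$, $Q_0(x)=\tilde Q_0(x)$ for almost every $x>0$, $h_0=\tilde h_0$ and $h_1=\tilde h_1$. Hence the Weyl matrix determines the coefficients of the pencil uniquely. -/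

import Mathlib

open MeasureTheory

/-- The coefficients of a quadratic pencil on the half-line with `m × m` complex matrices:
`ℓ_ρ(Y) = Y'' + (ρ² I + 2 i ρ Q₁(x) + Q₀(x)) Y` for `x > 0`, and
`U_ρ(Y) = Y'(0) + (i ρ h₁ + h₀) Y(0)`.
Only the values of `Q₀` and `Q₁` on `[0, ∞)` are ever used. -/
structure QuadraticPencil (m : ℕ) where
  Q₀ : ℝ → Matrix (Fin m) (Fin m) ℂ
  Q₁ : ℝ → Matrix (Fin m) (Fin m) ℂ
  h₀ : Matrix (Fin m) (Fin m) ℂ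
  h₁ : Matrix (Fin m) (Fin m) ℂ

namespace QuadraticPencil

variable {m : ℕ}

/-- The class `𝒱`: the entries of `Q₁` are absolutely continuous on every `[0, T]`, and the
entries of `Q₀`, `Q₁`, `Q₁'` belong to `L¹(0, ∞)` (`Q₁'` exists almost everywhere). -/
structure InClassV (L : QuadraticPencil m) : Prop where
  absCont_Q₁ : ∀ T : ℝ, 0 < T → ∀ j k : Fin m,
    AbsolutelyContinuousOnInterval (fun x => L.Q₁ x j k) 0 T
  integrable_Q₀ : ∀ j k : Fin m, IntegrableOn (fun x => L.Q₀ x j k) (Set.Ioi 0)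
  integrable_Q₁ : ∀ j k : Fin m, IntegrableOn (fun x => L.Q₁ x j k) (Set.Ioi 0)
  integrable_deriv_Q₁ : ∀ j k : Fin m,
    IntegrableOn (deriv fun x => L.Q₁ x j k) (Set.Ioi 0)

/-- The coefficient `ρ² I + 2 i ρ Q₁(x) + Q₀(x)`. -/
noncomputable def coeff (L : QuadraticPencil m) (ρ : ℂ) (x : ℝ) : Matrix (Fin m) (Fin m) ℂ :=
  ρ ^ 2 • (1 : Matrix (Fin m) (Fin m) ℂ) + (2 * Complex.I * ρ) • L.Q₁ x + L.Q₀ x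

/-- `Y` is a matrix solution of `ℓ_ρ(Y) = 0` on `[0, ∞)` and `Y'` is its derivative: the entries
of `Y` are differentiable on `[0, ∞)` (one-sidedly at `0`) with derivatives the entries of `Y'`,
which are absolutely continuous on every `[0, T]`, and `Y'' = -(ρ² I + 2 i ρ Q₁ + Q₀) Y` holds
almost everywhere on `(0, ∞)`. -/
structure IsSolution (L : QuadraticPencil m) (ρ : ℂ)
    (Y Y' : ℝ → Matrix (Fin m) (Fin m) ℂ) : Prop where
  hasDeriv : ∀ x : ℝ, 0 ≤ x → ∀ j k : Fin m,
    HasDerivWithinAt (fun t => Y t j k) (Y' x j k) (Set.Ici 0) x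
  absCont : ∀ T : ℝ, 0 < T → ∀ j k : Fin m,
    AbsolutelyContinuousOnInterval (fun x => Y' x j k) 0 T
  equation : ∀ᵐ x ∂(volume.restrict (Set.Ioi (0 : ℝ))), ∀ j k : Fin m,
    HasDerivAt (fun t => Y' t j k) (-((L.coeff ρ x * Y x) j k)) x

/-- `U_ρ(Y) = Y'(0) + (i ρ h₁ + h₀) Y(0)`. -/
noncomputable def boundaryForm (L : QuadraticPencil m) (ρ : ℂ)
    (Y Y' : ℝ → Matrix (Fin m) (Fin m) ℂ) : Matrix (Fin m) (Fin m) ℂ :=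
  Y' 0 + ((Complex.I * ρ) • L.h₁ + L.h₀) * Y 0

/-- `Φ`, with derivative `Φ'`, is a Weyl solution at the non-real point `ρ`:
`ℓ_ρ(Φ) = 0`, `U_ρ(Φ) = I`, and `Φ(x) = O(exp(± i ρ x))` as `x → ∞` if `± Im ρ > 0`. -/
structure IsWeylSolution (L : QuadraticPencil m) (ρ : ℂ)
    (Φ Φ' : ℝ → Matrix (Fin m) (Fin m) ℂ) : Prop where
  im_ne_zero : ρ.im ≠ 0
  isSolution : L.IsSolution ρ Φ Φ'
  boundary : L.boundaryForm ρ Φ Φ' = 1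
  growth_upper : 0 < ρ.im → ∀ j k : Fin m,
    (fun x : ℝ => Φ x j k) =O[Filter.atTop] fun x : ℝ => Complex.exp (Complex.I * ρ * x)
  growth_lower : ρ.im < 0 → ∀ j k : Fin m,
    (fun x : ℝ => Φ x j k) =O[Filter.atTop] fun x : ℝ => Complex.exp (-(Complex.I * ρ * x))

/-- `A` is the value `M(ρ) = Φ(0, ρ)` of the Weyl matrix at `ρ`. The Weyl matrix is a partial
function of `ρ ∈ ℂ ∖ ℝ` (it has poles); it is represented by its graph. -/
def IsWeylMatrixAt (L : QuadraticPencil m) (ρ : ℂ) (A : Matrix (Fin m) (Fin m) ℂ) : Prop :=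
  ∃ Φ Φ' : ℝ → Matrix (Fin m) (Fin m) ℂ, L.IsWeylSolution ρ Φ Φ' ∧ Φ 0 = A

end QuadraticPencil

/-! ### Absolutely continuous functions on the half-line. -/

open Set Filter Topology

/-! Write `c = 2iρ` and turn each pencil into a first-order system for `(Y, Y' - (c/2) Y)`. Let
`P(x, ρ)` be the 2 × 2 block matrix carrying solutions of the second pencil to solutions of the
first with the same `Y(0)` and the same boundary form. It satisfies a linear equation that is affine
in `ρ`, so for fixed `x` it is entire of exponential type in `ρ` (`exists_transformation`). If its
upper right block `P₀₁` vanishes for all `x`, the equation forces `P = 1`, and then the coefficients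
agree (`IsTransformation.eq_of_corner_eq_zero`).

To see that `P₀₁` vanishes, take `ρ` large in the sector `|ρ| ≤ 2 Im ρ`. A small solution `κ` of a
Riccati equation (`exists_riccati`) yields a decaying solution and coordinates in which the system
is triangular. As `det(I + h₁) ≠ 0`, the boundary form of the decaying solution is invertible for
such `ρ`, so a Weyl solution exists (`exists_riccati_isUnit`, `exists_decaying_solution`). Equality
of the Weyl values says that `P(0)` maps the decaying direction of one system to that of the other,
so `P` is triangular at `0` in the new coordinates (`triangular_initial`). It then stays triangular:
the entry that would grow is absent and the others are bounded by Grönwall. Returning to the old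
coordinates costs a factor `1/c` in the corner, so `P₀₁ = O(1/ρ)` (`norm_entry_zero_one_le`,
`corner_le`). The lower half-plane follows from `ρ ↦ -ρ`, which changes the sign of `h₁` and so
calls for `det(I - h₁) ≠ 0`.

Finally, Phragmén–Lindelöf in the four quadrants between the diagonals and Liouville's theorem give
`P₀₁ = 0` (`eq_zero_of_exp_type`). Uniqueness of Weyl solutions is never needed, because the
hypothesis concerns every pair of Weyl values. -/

theorem AbsolutelyContinuousOnInterval.of_dist_le {X Y Z : Type*} [PseudoMetricSpace X]
    [PseudoMetricSpace Y] [PseudoMetricSpace Z] {f : ℝ → X} {g : ℝ → Y} {h : ℝ → Z} {a b C D : ℝ}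
    (hf : AbsolutelyContinuousOnInterval f a b) (hg : AbsolutelyContinuousOnInterval g a b)
    (H : ∀ x ∈ uIcc a b, ∀ y ∈ uIcc a b,
      dist (h x) (h y) ≤ C * dist (f x) (f y) + D * dist (g x) (g y)) :
    AbsolutelyContinuousOnInterval h a b := by
  unfold AbsolutelyContinuousOnInterval at hf hg
  apply squeeze_zero' ?_ ?_ (by simpa using (hf.const_mul C).add (hg.const_mul D))
  · exact Eventually.of_forall fun _ => Finset.sum_nonneg fun i _ => dist_nonneg
  rw [eventually_inf_principal]
  filter_upwards with (n, I) hnI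
  simp only [Finset.mul_sum, ← Finset.sum_add_distrib]
  simp only [AbsolutelyContinuousOnInterval.disjWithin, mem_ofPred_eq] at hnI
  gcongr with i hi
  exact H _ (hnI.left i hi).left _ (hnI.left i hi).right

theorem continuousOn_Ici_of_absolutelyContinuousOnInterval {E : Type*}
    [NormedAddCommGroup E] {f : ℝ → E}
    (hf : ∀ T, 0 < T → AbsolutelyContinuousOnInterval f 0 T) : ContinuousOn f (Ici 0) := by
  intro x hx
  rw [mem_Ici] at hx
  have h := (hf (x + 1) (by linarith)).continuousOn
  rw [uIcc_of_le (by linarith)] at h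
  refine (h x ⟨hx, by linarith⟩).mono_of_mem_nhdsWithin ?_
  rw [← Ici_inter_Iic]
  exact inter_mem_nhdsWithin _ (Iic_mem_nhds (lt_add_one x))

/-! ### Calculus of functions given as integrals of locally integrable derivatives. -/

section

variable {E F : Type*} [NormedAddCommGroup E] [NormedSpace ℝ E] [NormedAddCommGroup F]
  [NormedSpace ℝ F]

theorem IntervalIntegrable.absolutelyContinuousOnInterval_integral {f : ℝ → E} {a b : ℝ}
    (h : IntervalIntegrable f volume a b) :
    AbsolutelyContinuousOnInterval (fun x => ∫ v in a..x, f v) a b := by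
  have hn := h.norm.absolutelyContinuousOnInterval_intervalIntegral (c := a) (by simp)
  refine hn.of_dist_le (C := 1) (D := 0) hn fun x hx y hy => ?_
  have ix : IntervalIntegrable f volume a x := h.mono_set (uIcc_subset_uIcc (by simp) hx)
  have iy : IntervalIntegrable f volume a y := h.mono_set (uIcc_subset_uIcc (by simp) hy)
  rw [dist_eq_norm, intervalIntegral.integral_interval_sub_left ix iy, Real.dist_eq,
    intervalIntegral.integral_interval_sub_left ix.norm iy.norm]
  simpa using intervalIntegral.norm_integral_le_abs_integral_norm

/-- Subtracting the primitive of `f'` leaves an absolutely continuous function with zero derivative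
almost everywhere, hence a constant. -/
theorem AbsolutelyContinuousOnInterval.sub_eq_integral [CompleteSpace E] {f f' : ℝ → E} {a b : ℝ}
    (hf : AbsolutelyContinuousOnInterval f a b)
    (hd : ∀ᵐ x, x ∈ uIcc a b → HasDerivAt f (f' x) x)
    (hi : IntervalIntegrable f' volume a b) :
    f b - f a = ∫ t in a..b, f' t := by
  have hg : AbsolutelyContinuousOnInterval (fun x => f x - ∫ t in a..x, f' t) a b :=
    hf.sub hi.absolutelyContinuousOnInterval_integral
  obtain ⟨C, hC⟩ := hg.const_of_ae_hasDerivAt_zero (by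
    filter_upwards [hd, hi.ae_hasDerivAt_integral] with x h1 h2 hx
    simpa using (h1 hx).fun_sub (h2 hx a (by simp)))
  have h1 := hC a (by simp)
  have h2 := hC b (by simp)
  simp only [intervalIntegral.integral_same, sub_zero] at h1
  simp only [← h1] at h2
  rw [← h2]; abel

/-- On `[0, ∞)` the function `f` is absolutely continuous with derivative `f'`. -/
def IsPrimitive (f f' : ℝ → E) : Prop :=
  ∀ x, 0 ≤ x → IntervalIntegrable f' volume 0 x ∧ f x = f 0 + ∫ t in 0..x, f' t

namespace IsPrimitive

theorem of_integral {f' : ℝ → E} (h : ∀ x, 0 ≤ x → IntervalIntegrable f' volume 0 x) (c : E) :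
    IsPrimitive (fun x => c + ∫ t in 0..x, f' t) f' :=
  fun x hx => ⟨h x hx, by simp⟩

variable {f f' : ℝ → E}

theorem congr (hf : IsPrimitive f f') {g g' : ℝ → E} (hg : ∀ x, 0 ≤ x → g x = f x)
    (hg' : ∀ᵐ x, 0 < x → g' x = f' x) : IsPrimitive g g' := by
  intro x hx
  obtain ⟨h1, h2⟩ := hf x hx
  have h : ∀ᵐ t, t ∈ uIoc 0 x → f' t = g' t := by
    filter_upwards [hg'] with t ht hxt
    rw [uIoc_of_le hx] at hxt
    exact (ht hxt.1).symm
  refine ⟨h1.congr_ae ((ae_restrict_iff' measurableSet_uIoc).2 h), ?_⟩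
  rw [hg x hx, hg 0 le_rfl, h2, intervalIntegral.integral_congr_ae h]

theorem absolutelyContinuous (hf : IsPrimitive f f') {T : ℝ} (hT : 0 ≤ T) :
    AbsolutelyContinuousOnInterval f 0 T := by
  have h := (hf T hT).1.absolutelyContinuousOnInterval_integral
  refine h.of_dist_le (C := 1) (D := 0) h fun x hx y hy => ?_
  rw [uIcc_of_le hT] at hx hy
  rw [(hf x hx.1).2, (hf y hy.1).2]
  simp

theorem continuousOn (hf : IsPrimitive f f') : ContinuousOn f (Ici 0) :=
  continuousOn_Ici_of_absolutelyContinuousOnInterval fun _ hT => hf.absolutelyContinuous hT.le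

theorem intervalIntegrable (hf : IsPrimitive f f') {x : ℝ} (hx : 0 ≤ x) :
    IntervalIntegrable f' volume 0 x := (hf x hx).1

theorem of_absolutelyContinuous [CompleteSpace E]
    (hf : ∀ T, 0 < T → AbsolutelyContinuousOnInterval f 0 T)
    (hd : ∀ᵐ x, 0 < x → HasDerivAt f (f' x) x)
    (hi : ∀ x, 0 ≤ x → IntervalIntegrable f' volume 0 x) : IsPrimitive f f' := by
  intro x hx
  refine ⟨hi x hx, ?_⟩
  rcases hx.eq_or_lt with rfl | hx'
  · simp
  have h0 : ∀ᵐ t : ℝ, t ≠ 0 := by simp [ae_iff, measure_singleton]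
  rw [← (hf x hx').sub_eq_integral _ (hi x hx)]
  · abel
  filter_upwards [hd, h0] with t ht ht0 htx
  rw [uIcc_of_le hx] at htx
  exact ht (lt_of_le_of_ne htx.1 ht0.symm)

theorem hasDerivAt_ae [CompleteSpace E] (hf : IsPrimitive f f') :
    ∀ᵐ x, 0 < x → HasDerivAt f (f' x) x := by
  have h : ∀ n : ℕ, ∀ᵐ x, x ∈ uIcc (0 : ℝ) n →
      ∀ c ∈ uIcc (0 : ℝ) n, HasDerivAt (fun x => ∫ t in c..x, f' t) (f' x) x :=
    fun n => (hf n n.cast_nonneg).1.ae_hasDerivAt_integral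
  filter_upwards [ae_all_iff.2 h] with x hx hx0
  obtain ⟨n, hn⟩ := exists_nat_ge x
  have h1 := hx n (by rw [uIcc_of_le n.cast_nonneg]; exact ⟨hx0.le, hn⟩) 0 (by simp)
  refine (h1.const_add (f 0)).congr_of_eventuallyEq ?_
  filter_upwards [Ioi_mem_nhds hx0] with y hy
  exact (hf y (le_of_lt hy)).2

theorem of_hasDerivAt [CompleteSpace E] (hd : ∀ x, HasDerivAt f (f' x) x) (hc : Continuous f') :
    IsPrimitive f f' := by
  intro x _
  refine ⟨hc.intervalIntegrable _ _, ?_⟩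
  rw [intervalIntegral.integral_eq_sub_of_hasDerivAt (fun t _ => hd t)
    (hc.intervalIntegrable _ _)]
  abel

theorem const (c : E) : IsPrimitive (fun _ => c) (fun _ => 0) := fun x _ => by simp

theorem add (hf : IsPrimitive f f') {g g' : ℝ → E} (hg : IsPrimitive g g') :
    IsPrimitive (fun x => f x + g x) (fun x => f' x + g' x) := by
  intro x hx
  refine ⟨(hf x hx).1.add (hg x hx).1, ?_⟩
  beta_reduce
  rw [intervalIntegral.integral_add (hf x hx).1 (hg x hx).1, (hf x hx).2, (hg x hx).2]
  abel

theorem sub (hf : IsPrimitive f f') {g g' : ℝ → E} (hg : IsPrimitive g g') :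
    IsPrimitive (fun x => f x - g x) (fun x => f' x - g' x) := by
  intro x hx
  refine ⟨(hf x hx).1.sub (hg x hx).1, ?_⟩
  beta_reduce
  rw [intervalIntegral.integral_sub (hf x hx).1 (hg x hx).1, (hf x hx).2, (hg x hx).2]
  abel

theorem clm [CompleteSpace E] [CompleteSpace F] (hf : IsPrimitive f f') (L : E →L[ℝ] F) :
    IsPrimitive (fun x => L (f x)) (fun x => L (f' x)) := by
  intro x hx
  refine ⟨⟨L.integrable_comp (hf x hx).1.1, L.integrable_comp (hf x hx).1.2⟩, ?_⟩
  rw [L.intervalIntegral_comp_comm (hf x hx).1, ← map_add, ← (hf x hx).2]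

theorem bilinear {G : Type*} [NormedAddCommGroup G] [NormedSpace ℝ G]
    [CompleteSpace E] [CompleteSpace F] [CompleteSpace G] (B : E →L[ℝ] F →L[ℝ] G)
    (hf : IsPrimitive f f') {g g' : ℝ → F} (hg : IsPrimitive g g') :
    IsPrimitive (fun x => B (f x) (g x)) (fun x => B (f' x) (g x) + B (f x) (g' x)) := by
  apply of_absolutelyContinuous
  · intro T hT
    have hfa := hf.absolutelyContinuous hT.le
    have hga := hg.absolutelyContinuous hT.le
    obtain ⟨C, hC⟩ := hfa.exists_bound
    obtain ⟨D, hD⟩ := hga.exists_bound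
    refine hfa.of_dist_le (C := ‖B‖ * D) (D := ‖B‖ * C) hga fun x hx y hy => ?_
    rw [dist_eq_norm, dist_eq_norm, dist_eq_norm]
    have : B (f x) (g x) - B (f y) (g y) = B (f x - f y) (g x) + B (f y) (g x - g y) := by simp
    rw [this]
    refine (norm_add_le _ _).trans (add_le_add ?_ ?_)
    · refine (B.le_opNorm₂ _ _).trans ?_
      rw [mul_assoc, mul_assoc, mul_comm D]
      gcongr
      exact hD x hx
    · refine (B.le_opNorm₂ _ _).trans ?_
      gcongr
      exact hC y hy
  · filter_upwards [hf.hasDerivAt_ae, hg.hasDerivAt_ae] with x h1 h2 hx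
    rw [add_comm]
    exact B.hasDerivAt_of_bilinear (fun _ => h1 hx) (fun _ => h2 hx)
  · intro x hx
    have cf : ContinuousOn f (uIcc 0 x) :=
      hf.continuousOn.mono (by rw [uIcc_of_le hx]; exact Icc_subset_Ici_self)
    have cg : ContinuousOn g (uIcc 0 x) :=
      hg.continuousOn.mono (by rw [uIcc_of_le hx]; exact Icc_subset_Ici_self)
    obtain ⟨C, hC⟩ := isCompact_uIcc.exists_bound_of_continuousOn cf
    obtain ⟨D, hD⟩ := isCompact_uIcc.exists_bound_of_continuousOn cg
    have i1 := (hf x hx).1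
    have i2 := (hg x hx).1
    rw [intervalIntegrable_iff] at i1 i2
    refine IntervalIntegrable.add ?_ ?_ <;> rw [intervalIntegrable_iff]
    · exact B.integrable_of_bilin_of_bdd_right D i1
        ((cg.mono uIoc_subset_uIcc).aestronglyMeasurable measurableSet_uIoc)
        ((ae_restrict_mem measurableSet_uIoc).mono fun t ht => hD t (uIoc_subset_uIcc ht))
    · exact B.integrable_of_bilin_of_bdd_left C
        ((cf.mono uIoc_subset_uIcc).aestronglyMeasurable measurableSet_uIoc)
        ((ae_restrict_mem measurableSet_uIoc).mono fun t ht => hC t (uIoc_subset_uIcc ht)) i2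

theorem mul {R : Type*} [NormedRing R] [NormedAlgebra ℝ R] [CompleteSpace R] {f f' g g' : ℝ → R}
    (hf : IsPrimitive f f') (hg : IsPrimitive g g') :
    IsPrimitive (fun x => f x * g x) (fun x => f' x * g x + f x * g' x) :=
  hf.bilinear (ContinuousLinearMap.mul ℝ R) hg

theorem smul {E : Type*} [NormedAddCommGroup E] [NormedSpace ℂ E] [CompleteSpace E]
    {c c' : ℝ → ℂ} {f f' : ℝ → E} (hc : IsPrimitive c c') (hf : IsPrimitive f f') :
    IsPrimitive (fun x => c x • f x) (fun x => c' x • f x + c x • f' x) :=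
  hc.bilinear (ContinuousLinearMap.lsmul ℝ ℂ) hf

theorem exp_mul {q k : ℝ → ℝ} (hq : IsPrimitive q k) (c : ℝ) :
    IsPrimitive (fun x => Real.exp (c * q x)) (fun x => c * (Real.exp (c * q x) * k x)) := by
  have hcont : ContinuousOn (fun x => Real.exp (c * q x)) (Ici 0) :=
    (hq.continuousOn.const_smul c).rexp
  apply of_absolutelyContinuous
  · intro T hT
    have hqa := hq.absolutelyContinuous hT.le
    obtain ⟨C, hC⟩ := hqa.exists_bound
    have hl : ContDiff ℝ 1 fun s : ℝ => Real.exp (c * s) := by fun_prop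
    obtain ⟨K, hK⟩ := hl.contDiffOn.exists_lipschitzOnWith (by decide)
      (convex_Icc (-C) C) isCompact_Icc
    refine hqa.of_dist_le (C := K) (D := 0) hqa fun x hx y hy => ?_
    have h := hK.dist_le_mul (q x) (abs_le.1 (hC x hx)) (q y) (abs_le.1 (hC y hy))
    simpa using h
  · filter_upwards [hq.hasDerivAt_ae] with x h hx
    convert! ((h hx).const_mul c).exp using 1
    ring
  · intro x hx
    exact ((hq.intervalIntegrable hx).continuousOn_mul
      (hcont.mono (by rw [uIcc_of_le hx]; exact Icc_subset_Ici_self))).const_mul c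

end IsPrimitive
end

/-! ### Linear equations with integrable coefficients: existence, growth, dependence on a parameter.
-/

section Volterra

/-- Grönwall's inequality with an integrable kernel. -/
theorem le_mul_exp_of_le_integral {f k : ℝ → ℝ} {a X : ℝ} (hf : ContinuousOn f (Ici 0))
    (hk : ∀ x, 0 ≤ x → IntervalIntegrable k volume 0 x) (hk0 : ∀ x, 0 ≤ k x)
    (h : ∀ x, 0 ≤ x → x ≤ X → f x ≤ a + ∫ t in 0..x, k t * f t) {x : ℝ} (hx : 0 ≤ x)
    (hxX : x ≤ X) :
    f x ≤ a * Real.exp (∫ t in 0..x, k t) := by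
  have hkf : ∀ x, 0 ≤ x → IntervalIntegrable (fun t => k t * f t) volume 0 x := fun x hx =>
    (hk x hx).mul_continuousOn (hf.mono (by rw [uIcc_of_le hx]; exact Icc_subset_Ici_self))
  have hG := IsPrimitive.of_integral hkf a
  have hq := IsPrimitive.of_integral hk 0
  have hP := (hG.mul (hq.exp_mul (-1))) x hx
  simp only [zero_add, intervalIntegral.integral_same, mul_zero, Real.exp_zero, mul_one,
    add_zero] at hP
  -- The majorant `a + ∫ k f` times `exp(-∫ k)` has derivative `k (f - majorant) exp(-∫ k) ≤ 0`.
  have hneg : ∫ t in 0..x, (k t * f t * Real.exp (-1 * ∫ s in 0..t, k s) +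
      (a + ∫ s in 0..t, k s * f s) * (-1 * (Real.exp (-1 * ∫ s in 0..t, k s) * k t))) ≤ 0 := by
    rw [← neg_nonneg, ← intervalIntegral.integral_neg]
    refine intervalIntegral.integral_nonneg hx fun t ht => ?_
    have h1 := h t ht.1 (ht.2.trans hxX)
    have h2 : 0 ≤ k t * Real.exp (-1 * ∫ s in 0..t, k s) :=
      mul_nonneg (hk0 t) (Real.exp_pos _).le
    nlinarith
  have hfin := hP.2.le.trans (add_le_of_nonpos_right hneg)
  calc f x ≤ a + ∫ t in 0..x, k t * f t := h x hx hxX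
    _ = (a + ∫ t in 0..x, k t * f t) * Real.exp (-1 * ∫ t in 0..x, k t) *
        Real.exp (∫ t in 0..x, k t) := by
      rw [mul_assoc, ← Real.exp_add]; simp
    _ ≤ _ := mul_le_mul_of_nonneg_right hfin (Real.exp_pos _).le

variable {E : Type*} [NormedAddCommGroup E] [NormedSpace ℂ E]

/-- A time-dependent linear operator on `[0, ∞)` with locally integrable bound `k`. -/
structure IsVolterra (L : ℝ → E →ₗ[ℂ] E) (k : ℝ → ℝ) : Prop where
  integrable : ∀ x, 0 ≤ x → IntervalIntegrable k volume 0 x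
  bound : ∀ t y, ‖L t y‖ ≤ k t * ‖y‖
  nonneg : ∀ t, 0 ≤ k t
  measurable : ∀ y : ℝ → E, ContinuousOn y (Ici 0) → ∀ x, 0 ≤ x →
    AEStronglyMeasurable (fun t => L t (y t)) (volume.restrict (Ioc 0 x))

namespace IsVolterra

variable {L : ℝ → E →ₗ[ℂ] E} {k : ℝ → ℝ}

theorem intervalIntegrable (hL : IsVolterra L k) {y : ℝ → E} (hy : ContinuousOn y (Ici 0))
    {x : ℝ} (hx : 0 ≤ x) : IntervalIntegrable (fun t => L t (y t)) volume 0 x := by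
  have h1 : IntervalIntegrable (fun t => k t * ‖y t‖) volume 0 x :=
    (hL.integrable x hx).mul_continuousOn
      (hy.norm.mono (by rw [uIcc_of_le hx]; exact Icc_subset_Ici_self))
  rw [intervalIntegrable_iff_integrableOn_Ioc_of_le hx] at h1 ⊢
  exact h1.mono' (hL.measurable y hy x hx) (ae_of_all _ fun t => hL.bound t _)

theorem norm_le (hL : IsVolterra L k) {y g : ℝ → E}
    (hy : IsPrimitive y (fun t => L t (y t) + g t)) {b X : ℝ} {x : ℝ} (hx : 0 ≤ x) (hxX : x ≤ X)
    (hg : ∀ x, 0 ≤ x → x ≤ X → ‖∫ t in 0..x, g t‖ ≤ b) :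
    ‖y x‖ ≤ (‖y 0‖ + b) * Real.exp (∫ t in 0..x, k t) := by
  refine le_mul_exp_of_le_integral (f := fun x => ‖y x‖) hy.continuousOn.norm hL.integrable
    hL.nonneg (fun x hx hxX => ?_) hx hxX
  have h1 := hL.intervalIntegrable hy.continuousOn hx
  have h2 : IntervalIntegrable g volume 0 x := by
    simpa using ((hy x hx).1.sub h1)
  rw [(hy x hx).2, intervalIntegral.integral_add h1 h2, add_assoc]
  refine (norm_add_le _ _).trans (add_le_add_right ?_ _)
  rw [add_comm]
  refine (norm_add_le _ _).trans (add_le_add (hg x hx hxX) ?_)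
  exact intervalIntegral.norm_integral_le_of_norm_le hx (ae_of_all _ fun t _ => hL.bound t _)
    ((hL.integrable x hx).mul_continuousOn
      (hy.continuousOn.norm.mono (by rw [uIcc_of_le hx]; exact Icc_subset_Ici_self)))

theorem norm_le_of_homogeneous (hL : IsVolterra L k) {y : ℝ → E}
    (hy : IsPrimitive y (fun t => L t (y t))) {x : ℝ} (hx : 0 ≤ x) :
    ‖y x‖ ≤ ‖y 0‖ * Real.exp (∫ t in 0..x, k t) := by
  simpa using hL.norm_le (g := fun _ => 0) (b := 0) (by simpa using hy) hx le_rfl (by simp)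

/-- Picard iteration in the norm `sup exp(-2q) ‖y‖` with `q = ∫ k`. Since `∫₀ˣ k exp(2q) ≤
exp(2q(x)) / 2`, the integral operator is a contraction with constant 1/2 on the whole half-line at
once. -/
theorem exists_solution [CompleteSpace E] (hL : IsVolterra L k) (y₀ : E) :
    ∃ y : ℝ → E, y 0 = y₀ ∧ IsPrimitive y (fun t => L t (y t)) := by
  set q : ℝ → ℝ := fun x => ∫ t in 0..x, k t with hq
  have hqP : IsPrimitive q k := by simpa using IsPrimitive.of_integral hL.integrable 0
  have hq0 : q 0 = 0 := by simp [hq]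
  have hqnn : ∀ x, 0 ≤ x → 0 ≤ q x := fun x hx =>
    intervalIntegral.integral_nonneg hx fun t _ => hL.nonneg t
  have hexp := hqP.exp_mul 2
  set w : (ℝ → E) → ℝ → E := fun Z x => Real.exp (2 * q x) • Z x with hw
  have hwc : ∀ Z : ℝ → E, Continuous Z → ContinuousOn (w Z) (Ici 0) := fun Z hZ =>
    hexp.continuousOn.smul hZ.continuousOn
  have hint : ∀ Z : ℝ → E, Continuous Z → ∀ M, (∀ x, ‖Z x‖ ≤ M) → ∀ x, 0 ≤ x →
      Real.exp (-2 * q x) * ‖∫ t in 0..x, L t (w Z t)‖ ≤ M / 2 := by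
    intro Z hZ M hM x hx
    have hM0 : 0 ≤ M := (norm_nonneg _).trans (hM 0)
    have h1 : ‖∫ t in 0..x, L t (w Z t)‖ ≤
        ∫ t in 0..x, M / 2 * (2 * (Real.exp (2 * q t) * k t)) := by
      refine intervalIntegral.norm_integral_le_of_norm_le hx (ae_of_all _ fun t _ => ?_)
        ((hexp.intervalIntegrable hx).const_mul _)
      refine (hL.bound t _).trans ?_
      rw [hw, norm_smul, Real.norm_of_nonneg (Real.exp_pos _).le]
      calc k t * (Real.exp (2 * q t) * ‖Z t‖) ≤ k t * (Real.exp (2 * q t) * M) := by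
            gcongr
            · exact hL.nonneg t
            · exact hM t
        _ = _ := by ring
    have h2 := (hexp x hx).2
    rw [intervalIntegral.integral_const_mul] at h1
    simp only [hq0, mul_zero, Real.exp_zero] at h2
    calc _ ≤ Real.exp (-2 * q x) * (M / 2 * Real.exp (2 * q x)) := by
          gcongr
          refine h1.trans (mul_le_mul_of_nonneg_left ?_ (by positivity))
          rw [h2]; linarith
      _ = M / 2 * Real.exp (-2 * q x + 2 * q x) := by rw [Real.exp_add]; ring
      _ = M / 2 := by simp
  have hSP : ∀ Z : ℝ → E, Continuous Z →
      IsPrimitive (fun x => y₀ + ∫ t in 0..x, L t (w Z t)) (fun t => L t (w Z t)) := fun Z hZ =>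
    IsPrimitive.of_integral (fun x hx => hL.intervalIntegrable (hwc Z hZ) hx) y₀
  -- The unknown is `Z = exp(-2q) y`. Freezing the argument at `max x 0` extends it to the line, so
  -- that bounded continuous functions on `ℝ` can serve as the complete space.
  set T : (ℝ → E) → ℝ → E := fun Z x =>
    Real.exp (-2 * q (max x 0)) • (y₀ + ∫ t in 0..(max x 0), L t (w Z t)) with hT
  have hTc : ∀ Z : ℝ → E, Continuous Z → Continuous (T Z) := fun Z hZ =>
    ((hqP.exp_mul (-2)).continuousOn.smul (hSP Z hZ).continuousOn).comp_continuous
      (f := fun x : ℝ => max x 0) (by fun_prop) (fun x => le_max_right x 0)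
  have hTb : ∀ Z : ℝ → E, Continuous Z → ∀ M, (∀ x, ‖Z x‖ ≤ M) → ∀ x,
      ‖T Z x‖ ≤ ‖y₀‖ + M / 2 := by
    intro Z hZ M hM x
    have h0 : 0 ≤ max x 0 := le_max_right x 0
    simp only [hT, smul_add]
    refine (norm_add_le _ _).trans (add_le_add ?_ ?_)
    · rw [norm_smul, Real.norm_of_nonneg (Real.exp_pos _).le]
      refine mul_le_of_le_one_left (norm_nonneg _) (Real.exp_le_one_iff.2 ?_)
      linarith [hqnn _ h0]
    · rw [norm_smul, Real.norm_of_nonneg (Real.exp_pos _).le]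
      exact hint Z hZ M hM _ h0
  let Φ : BoundedContinuousFunction ℝ E → BoundedContinuousFunction ℝ E := fun Z =>
    BoundedContinuousFunction.ofNormedAddCommGroup (T Z) (hTc Z Z.continuous) (‖y₀‖ + ‖Z‖ / 2)
      (hTb Z Z.continuous ‖Z‖ Z.norm_coe_le_norm)
  have hΦ : ContractingWith (1 / 2) Φ := by
    refine ⟨by norm_num, LipschitzWith.of_dist_le_mul fun Z Z' => ?_⟩
    rw [BoundedContinuousFunction.dist_le (by positivity)]
    intro x
    have h0 : 0 ≤ max x 0 := le_max_right x 0
    have h1 := hint (fun t => Z t - Z' t) (Z.continuous.sub Z'.continuous) (dist Z Z')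
      (fun t => by rw [← dist_eq_norm]; exact Z.dist_coe_le_dist t) (max x 0) h0
    have h2 : ∀ t, L t (w (fun t => Z t - Z' t) t) = L t (w Z t) - L t (w Z' t) := fun t => by
      simp only [hw, smul_sub, map_sub]
    simp only [h2] at h1
    rw [intervalIntegral.integral_sub (hL.intervalIntegrable (hwc Z Z.continuous) h0)
      (hL.intervalIntegrable (hwc Z' Z'.continuous) h0)] at h1
    have h3 : dist (Φ Z x) (Φ Z' x) = Real.exp (-2 * q (max x 0)) *
        ‖(∫ t in 0..(max x 0), L t (w Z t)) - ∫ t in 0..(max x 0), L t (w Z' t)‖ := by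
      rw [dist_eq_norm]
      change ‖T Z x - T Z' x‖ = _
      rw [hT, ← smul_sub, norm_smul, Real.norm_of_nonneg (Real.exp_pos _).le]
      congr 2
      abel
    rw [h3]
    refine h1.trans (le_of_eq ?_)
    simp
    ring
  obtain ⟨Z, hZ, -⟩ := hΦ.exists_fixedPoint (0 : BoundedContinuousFunction ℝ E) (edist_ne_top _ _)
  have hfix : ∀ x, 0 ≤ x → w Z x = y₀ + ∫ t in 0..x, L t (w Z t) := by
    intro x hx
    have h1 : Z x = T Z x := congrArg (fun f : BoundedContinuousFunction ℝ E => f x) hZ.symm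
    change Real.exp (2 * q x) • Z x = _
    rw [h1]
    change Real.exp (2 * q x) • (Real.exp (-2 * q (max x 0)) • _) = _
    rw [smul_smul, ← Real.exp_add, max_eq_left hx]
    simp only [neg_mul, add_neg_cancel, Real.exp_zero, one_smul]
  refine ⟨w Z, ?_, (hSP Z Z.continuous).congr hfix (ae_of_all _ fun _ _ => rfl)⟩
  simpa using hfix 0 le_rfl

theorem add_smul {L₀ L₁ : ℝ → E →ₗ[ℂ] E} {k₀ k₁ : ℝ → ℝ} (h₀ : IsVolterra L₀ k₀)
    (h₁ : IsVolterra L₁ k₁) {ρ : ℂ} {r : ℝ} (hr : ‖ρ‖ ≤ r) :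
    IsVolterra (fun t => L₀ t + ρ • L₁ t) (fun t => k₀ t + r * k₁ t) where
  integrable x hx := (h₀.integrable x hx).add ((h₁.integrable x hx).const_mul r)
  bound t y := by
    rw [LinearMap.add_apply, LinearMap.smul_apply, add_mul]
    refine (norm_add_le _ _).trans (add_le_add (h₀.bound t y) ?_)
    rw [norm_smul, mul_assoc]
    exact mul_le_mul hr (h₁.bound t y) (norm_nonneg _) ((norm_nonneg _).trans hr)
  nonneg t := add_nonneg (h₀.nonneg t) (mul_nonneg ((norm_nonneg _).trans hr) (h₁.nonneg t))
  measurable y hy x hx := by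
    simp only [LinearMap.add_apply, LinearMap.smul_apply]
    exact (h₀.measurable y hy x hx).add ((h₁.measurable y hy x hx).const_smul ρ)

/-- The pair `(y, z)` solves a homogeneous block-triangular equation on `E × E`. With `L₁` the
derivative of the coefficient in the parameter, `z` is the candidate for the derivative of `y`. -/
theorem exists_solution_inhomogeneous [CompleteSpace E] {L₁ : ℝ → E →ₗ[ℂ] E} {k₁ : ℝ → ℝ}
    (h : IsVolterra L k) (h₁ : IsVolterra L₁ k₁) (y₀ z₀ : E) :
    ∃ y z : ℝ → E, y 0 = y₀ ∧ z 0 = z₀ ∧ IsPrimitive y (fun t => L t (y t)) ∧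
      IsPrimitive z (fun t => L t (z t) + L₁ t (y t)) := by
  have H : IsVolterra (fun t => LinearMap.prod (L t ∘ₗ LinearMap.fst ℂ E E)
      (L t ∘ₗ LinearMap.snd ℂ E E + L₁ t ∘ₗ LinearMap.fst ℂ E E)) (fun t => k t + k₁ t) := by
    refine ⟨fun x hx => (h.integrable x hx).add (h₁.integrable x hx), fun t y => ?_,
      fun t => add_nonneg (h.nonneg t) (h₁.nonneg t), fun y hy x hx => ?_⟩
    · change max ‖L t y.1‖ ‖L t y.2 + L₁ t y.1‖ ≤ (k t + k₁ t) * ‖y‖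
      rw [add_mul]
      have e1 : ‖L t y.1‖ ≤ k t * ‖y‖ :=
        (h.bound t _).trans (mul_le_mul_of_nonneg_left (norm_fst_le y) (h.nonneg t))
      have e2 : ‖L t y.2‖ ≤ k t * ‖y‖ :=
        (h.bound t _).trans (mul_le_mul_of_nonneg_left (norm_snd_le y) (h.nonneg t))
      have e3 : ‖L₁ t y.1‖ ≤ k₁ t * ‖y‖ :=
        (h₁.bound t _).trans (mul_le_mul_of_nonneg_left (norm_fst_le y) (h₁.nonneg t))
      have e4 : 0 ≤ k₁ t * ‖y‖ := mul_nonneg (h₁.nonneg t) (norm_nonneg _)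
      refine max_le ?_ ((norm_add_le _ _).trans ?_) <;> linarith
    · exact (h.measurable _ (continuous_fst.comp_continuousOn hy) x hx).prodMk
        ((h.measurable _ (continuous_snd.comp_continuousOn hy) x hx).add
          (h₁.measurable _ (continuous_fst.comp_continuousOn hy) x hx))
  obtain ⟨y, hy0, hy⟩ := H.exists_solution (y₀, z₀)
  refine ⟨fun t => (y t).1, fun t => (y t).2, by simp [hy0], by simp [hy0], ?_, ?_⟩
  · exact hy.clm (ContinuousLinearMap.fst ℝ E E)
  · exact hy.clm (ContinuousLinearMap.snd ℝ E E)

/-- Solutions of a linear equation depending affinely on a complex parameter are entire in it. -/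
theorem differentiable_solution [CompleteSpace E] {L₀ L₁ : ℝ → E →ₗ[ℂ] E} {k₀ k₁ : ℝ → ℝ}
    (h₀ : IsVolterra L₀ k₀) (h₁ : IsVolterra L₁ k₁) {y : ℂ → ℝ → E} {c₀ c₁ : E}
    (hy0 : ∀ ρ, y ρ 0 = c₀ + ρ • c₁)
    (hy : ∀ ρ, IsPrimitive (y ρ) (fun t => (L₀ t + ρ • L₁ t) (y ρ t))) {x : ℝ} (hx : 0 ≤ x) :
    Differentiable ℂ (fun ρ => y ρ x) := by
  intro ρ
  have hL := h₀.add_smul h₁ (le_refl ‖ρ‖)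
  obtain ⟨u, z, hu0, hz0, hu, hz⟩ := hL.exists_solution_inhomogeneous h₁ (y ρ 0) c₁
  have huy : ∀ t, 0 ≤ t → u t = y ρ t := by
    intro t ht
    have h := hL.norm_le_of_homogeneous (y := fun t => u t - y ρ t)
      (by simpa only [map_sub] using hu.sub (hy ρ)) ht
    rw [hu0, sub_self, norm_zero, zero_mul, norm_le_zero_iff] at h
    exact sub_eq_zero.1 h
  replace hz : IsPrimitive z (fun t => (L₀ t + ρ • L₁ t) (z t) + L₁ t (y ρ t)) :=
    hz.congr (fun _ _ => rfl) (ae_of_all _ fun t ht => by rw [huy t ht.le])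
  have bound : ∀ (g : ℝ → E) (M : ℝ), ContinuousOn g (Ici 0) → 0 ≤ M →
      (∀ t, 0 ≤ t → t ≤ x → ‖g t‖ ≤ M) → ∀ s, 0 ≤ s → s ≤ x → ∀ c : ℂ,
      ‖∫ t in 0..s, c • L₁ t (g t)‖ ≤ ‖c‖ * (M * ∫ t in 0..x, k₁ t) := by
    intro g M hg hM hgM s hs hsx c
    rw [intervalIntegral.integral_smul, norm_smul]
    refine mul_le_mul_of_nonneg_left ?_ (norm_nonneg c)
    rw [← intervalIntegral.integral_const_mul]
    refine (intervalIntegral.norm_integral_le_of_norm_le hs (g := fun t => M * k₁ t)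
      (ae_of_all _ fun t ht => (h₁.bound t _).trans ?_)
      ((h₁.integrable s hs).const_mul M)).trans ?_
    · rw [mul_comm M]
      exact mul_le_mul_of_nonneg_left (hgM t ht.1.le (ht.2.trans hsx)) (h₁.nonneg t)
    · exact intervalIntegral.integral_mono_interval le_rfl hs hsx
        (ae_of_all _ fun t => mul_nonneg hM (h₁.nonneg t)) ((h₁.integrable x hx).const_mul M)
  have kmono : ∀ {k : ℝ → ℝ} {L : ℝ → E →ₗ[ℂ] E}, IsVolterra L k → ∀ s, 0 ≤ s → s ≤ x →
      ∫ t in 0..s, k t ≤ ∫ t in 0..x, k t := fun h s hs hsx =>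
    intervalIntegral.integral_mono_interval le_rfl hs hsx (ae_of_all _ fun t => h.nonneg t)
      (h.integrable x hx)
  obtain ⟨M, hM⟩ := isCompact_Icc.exists_bound_of_continuousOn
    ((hy ρ).continuousOn.mono (Icc_subset_Ici_self : Icc 0 x ⊆ Ici 0))
  have hM0 : 0 ≤ M := (norm_nonneg _).trans (hM 0 ⟨le_rfl, hx⟩)
  set I₁ := ∫ t in 0..x, k₁ t
  have hI₁ : 0 ≤ I₁ := intervalIntegral.integral_nonneg hx fun t _ => h₁.nonneg t
  set D := (‖c₁‖ + M * I₁) * Real.exp (∫ t in 0..x, (k₀ t + (‖ρ‖ + 1) * k₁ t)) with hD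
  have hD0 : 0 ≤ D := by positivity
  -- The difference `d` has forcing and initial value of order `h`, so `d = O(h)`. The remainder `d
  -- - h z` starts at `0` with forcing `h L₁ d = O(h²)`. The restriction `‖h‖ ≤ 1` makes the
  -- Grönwall kernel, with `‖ρ‖ + 1`, independent of `h`.
  have key : ∀ h : ℂ, ‖h‖ ≤ 1 → ‖y (ρ + h) x - y ρ x - h • z x‖ ≤
      (D * I₁ * Real.exp (∫ t in 0..x, (k₀ t + ‖ρ‖ * k₁ t))) * ‖h‖ ^ 2 := by
    intro h hh
    have hLh := h₀.add_smul h₁ (ρ := ρ + h) (r := ‖ρ‖ + 1)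
      ((norm_add_le _ _).trans (by linarith))
    set d : ℝ → E := fun t => y (ρ + h) t - y ρ t with hd
    have hdP : IsPrimitive d (fun t => (L₀ t + (ρ + h) • L₁ t) (d t) + h • L₁ t (y ρ t)) := by
      refine ((hy (ρ + h)).sub (hy ρ)).congr (fun _ _ => rfl) (ae_of_all _ fun t _ => ?_)
      simp only [hd, LinearMap.add_apply, LinearMap.smul_apply, map_sub]
      module
    have hd0 : d 0 = h • c₁ := by
      simp only [hd, hy0]; module
    have hdb : ∀ t, 0 ≤ t → t ≤ x → ‖d t‖ ≤ ‖h‖ * D := by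
      intro t ht htx
      refine (hLh.norm_le hdP ht htx (b := ‖h‖ * (M * I₁)) fun s hs hsx =>
        bound _ M (hy ρ).continuousOn hM0 (fun r hr hrx => hM r ⟨hr, hrx⟩) s hs hsx h).trans ?_
      rw [hd0, norm_smul, ← mul_add, mul_assoc, hD]
      gcongr
      exact kmono hLh t ht htx
    set e : ℝ → E := fun t => d t - h • z t with he
    have heP : IsPrimitive e (fun t => (L₀ t + ρ • L₁ t) (e t) + h • L₁ t (d t)) := by
      have hz' := (IsPrimitive.const h).smul hz
      refine (hdP.sub hz').congr (fun _ _ => rfl) (ae_of_all _ fun t _ => ?_)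
      simp only [he, LinearMap.add_apply, LinearMap.smul_apply, map_sub, map_smul, zero_smul]
      have : L₁ t (d t) = L₁ t (y (ρ + h) t) - L₁ t (y ρ t) := by rw [hd, map_sub]
      rw [this]
      module
    have he0 : e 0 = 0 := by simp [he, hd0, hz0]
    have := hL.norm_le heP hx le_rfl (b := ‖h‖ * ((‖h‖ * D) * I₁)) fun s hs hsx =>
      bound _ _ hdP.continuousOn (by positivity) hdb s hs hsx h
    refine this.trans (le_of_eq ?_)
    rw [he0, norm_zero]
    ring
  refine HasDerivAt.differentiableAt (f' := z x) ?_
  rw [hasDerivAt_iff_isLittleO_nhds_zero]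
  refine Asymptotics.IsBigO.trans_isLittleO (g := fun h : ℂ => ‖h‖ ^ 2) ?_
    (Asymptotics.isLittleO_norm_pow_id one_lt_two)
  refine Asymptotics.IsBigO.of_bound
    (D * I₁ * Real.exp (∫ t in 0..x, (k₀ t + ‖ρ‖ * k₁ t))) ?_
  filter_upwards [Metric.closedBall_mem_nhds (0 : ℂ) one_pos] with h hh
  rw [norm_pow, norm_norm]
  exact key h (by simpa using hh)

end IsVolterra

end Volterra

/-! ### The small solution of the Riccati equation on the half-line. -/

section Riccati

variable {A : Type*} [NormedRing A] [NormedAlgebra ℂ A]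

theorem isPrimitive_cexp (c : ℂ) :
    IsPrimitive (fun x : ℝ => Complex.exp (c * x)) (fun x => c * Complex.exp (c * x)) := by
  refine IsPrimitive.of_hasDerivAt (fun x => ?_) (by fun_prop)
  have h : HasDerivAt (fun x : ℝ => c * (x : ℂ)) c x := by
    simpa using (Complex.ofRealCLM.hasDerivAt (x := x)).const_mul c
  simpa [mul_comm] using h.cexp

theorem integrableOn_mul_mul {A : Type*} [NormedRing A]
    {E κ₁ κ₂ : ℝ → A} (hE : IntegrableOn E (Ioi 0))
    (h₁ : Continuous κ₁) (h₂ : Continuous κ₂) {C : ℝ} (hb₁ : ∀ x, ‖κ₁ x‖ ≤ C)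
    (hb₂ : ∀ x, ‖κ₂ x‖ ≤ C) : IntegrableOn (fun t => κ₁ t * E t * κ₂ t) (Ioi 0) :=
  (hE.bdd_mul (c := C) h₁.aestronglyMeasurable (ae_of_all _ hb₁)).mul_bdd (c := C)
    h₂.aestronglyMeasurable (ae_of_all _ hb₂)

/-- The solution of `v' = -2 i ρ v - F` that is bounded at infinity. -/
noncomputable def tailIntegral (ρ : ℂ) (F : ℝ → A) (x : ℝ) : A :=
  ∫ t in Ioi x, Complex.exp (2 * Complex.I * ρ * (t - x)) • F t

variable {ρ : ℂ} {F : ℝ → A}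

theorem norm_cexp_two_mul (ρ : ℂ) (s : ℝ) :
    ‖Complex.exp (2 * Complex.I * ρ * s)‖ = Real.exp (-2 * ρ.im * s) := by
  rw [Complex.norm_exp]; simp

theorem norm_tailIntegral_le (x : ℝ) :
    ‖tailIntegral ρ F x‖ ≤ ∫ t in Ioi x, Real.exp (-2 * ρ.im * (t - x)) * ‖F t‖ := by
  refine (norm_integral_le_integral_norm _).trans (le_of_eq ?_)
  refine integral_congr_ae (ae_of_all _ fun t => ?_)
  simp only
  rw [norm_smul, ← Complex.ofReal_sub, norm_cexp_two_mul]

theorem integrableOn_exp_smul (hρ : 0 ≤ ρ.im) (hF : IntegrableOn F (Ioi 0)) {x : ℝ} (hx : 0 ≤ x) :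
    IntegrableOn (fun t : ℝ => Complex.exp (2 * Complex.I * ρ * (t - x)) • F t) (Ioi x) := by
  refine Integrable.bdd_smul (φ := fun t : ℝ => Complex.exp (2 * Complex.I * ρ * (t - x)))
    (hF.mono_set (Ioi_subset_Ioi hx)) 1 (Continuous.aestronglyMeasurable (by fun_prop)) ?_
  refine (ae_restrict_mem measurableSet_Ioi).mono fun t ht => ?_
  rw [← Complex.ofReal_sub, norm_cexp_two_mul, Real.exp_le_one_iff]
  have := sub_pos.2 (mem_Ioi.1 ht)
  nlinarith [mul_nonneg hρ this.le]

theorem tailIntegral_sub {G : ℝ → A} (hρ : 0 ≤ ρ.im) (hF : IntegrableOn F (Ioi 0))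
    (hG : IntegrableOn G (Ioi 0)) {x : ℝ} (hx : 0 ≤ x) :
    tailIntegral ρ F x - tailIntegral ρ G x = tailIntegral ρ (fun t => F t - G t) x := by
  rw [tailIntegral, tailIntegral, ← integral_sub (integrableOn_exp_smul hρ hF hx)
    (integrableOn_exp_smul hρ hG hx)]
  simp only [tailIntegral, smul_sub]

variable [CompleteSpace A]

theorem isPrimitive_tailIntegral (hρ : 0 ≤ ρ.im) (hF : IntegrableOn F (Ioi 0)) :
    IsPrimitive (tailIntegral ρ F)
      (fun x => (-2 * Complex.I * ρ) • tailIntegral ρ F x - F x) := by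
  have hg := integrableOn_exp_smul hρ hF le_rfl
  simp only [Complex.ofReal_zero, sub_zero] at hg
  set g : ℝ → A := fun t => Complex.exp (2 * Complex.I * ρ * t) • F t with hgdef
  have hgi : ∀ x, 0 ≤ x → IntervalIntegrable g volume 0 x := fun x hx => by
    rw [intervalIntegrable_iff_integrableOn_Ioc_of_le hx]
    exact hg.mono_set Ioc_subset_Ioi_self
  have hP := (isPrimitive_cexp (-2 * Complex.I * ρ)).smul
    ((IsPrimitive.const (∫ t in Ioi 0, g t)).sub (IsPrimitive.of_integral hgi 0))
  have heq : ∀ x, 0 ≤ x → tailIntegral ρ F x = Complex.exp (-2 * Complex.I * ρ * x) •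
      ((∫ t in Ioi 0, g t) - (0 + ∫ t in 0..x, g t)) := by
    intro x hx
    rw [zero_add, ← intervalIntegral.integral_Ioi_sub_Ioi hg hx, sub_sub_cancel, ← integral_smul,
      tailIntegral]
    refine integral_congr_ae (ae_of_all _ fun t => ?_)
    simp only [hgdef]
    rw [smul_smul, ← Complex.exp_add]
    congr 2
    ring
  refine hP.congr heq (ae_of_all _ fun x hx => ?_)
  simp only [heq x hx.le, zero_sub, smul_neg, mul_smul]
  rw [sub_eq_add_neg]
  congr 2
  simp only [hgdef, smul_smul, ← Complex.exp_add]
  simp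

variable [NormOneClass A] in
/-- The solution of the Riccati equation `κ' = -2 i ρ κ + (1 + κ) E (1 + κ)` that is small on the
half-line. -/
theorem exists_riccati (hρ : 0 ≤ ρ.im) {E : ℝ → A} (hE : IntegrableOn E (Ioi 0)) {θ : ℝ}
    (hθ : ∀ x, 0 ≤ x → ∫ t in Ioi x, Real.exp (-2 * ρ.im * (t - x)) * ‖E t‖ ≤ θ)
    (hθ8 : θ ≤ 1 / 8) :
    ∃ κ : ℝ → A, Continuous κ ∧ (∀ x, ‖κ x‖ ≤ 1) ∧ (∀ x, 0 ≤ x → ‖κ x‖ ≤ 4 * θ) ∧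
      IsPrimitive κ (fun x => (-2 * Complex.I * ρ) • κ x + (1 + κ x) * E x * (1 + κ x)) := by
  have hθ0 : 0 ≤ θ := (integral_nonneg fun t => by positivity).trans (hθ 0 le_rfl)
  have hEexp : ∀ x, 0 ≤ x →
      IntegrableOn (fun t => Real.exp (-2 * ρ.im * (t - x)) * ‖E t‖) (Ioi x) := fun x hx => by
    refine (integrableOn_exp_smul hρ hE hx).norm.congr (ae_of_all _ fun t => ?_)
    simp only
    rw [norm_smul, ← Complex.ofReal_sub, norm_cexp_two_mul]
  have tail_le : ∀ (F : ℝ → A) (c : ℝ), 0 ≤ c → (∀ t, ‖F t‖ ≤ c * ‖E t‖) → ∀ x, 0 ≤ x →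
      ‖tailIntegral ρ F x‖ ≤ c * θ := by
    intro F c hc hF x hx
    refine (norm_tailIntegral_le x).trans
      (le_trans ?_ (mul_le_mul_of_nonneg_left (hθ x hx) hc))
    rw [← integral_const_mul]
    refine integral_mono_of_nonneg (ae_of_all _ fun t => by positivity)
      ((hEexp x hx).const_mul c) (ae_of_all _ fun t => ?_)
    calc Real.exp (-2 * ρ.im * (t - x)) * ‖F t‖
        ≤ Real.exp (-2 * ρ.im * (t - x)) * (c * ‖E t‖) := by gcongr; exact hF t
      _ = _ := by ring
  have one_add_le : ∀ a : A, ‖a‖ ≤ 1 → ‖1 + a‖ ≤ 2 := fun a ha =>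
    (norm_add_le _ _).trans (by rw [norm_one]; linarith)
  set N : (ℝ → A) → ℝ → A := fun κ t => (1 + κ t) * E t * (1 + κ t) with hN
  have hNi : ∀ κ : ℝ → A, Continuous κ → (∀ x, ‖κ x‖ ≤ 1) → IntegrableOn (N κ) (Ioi 0) :=
    fun κ hc hb => integrableOn_mul_mul hE (by fun_prop) (by fun_prop)
      (fun x => one_add_le _ (hb x)) (fun x => one_add_le _ (hb x))
  have hNb : ∀ κ : ℝ → A, (∀ x, ‖κ x‖ ≤ 1) → ∀ t, ‖N κ t‖ ≤ 4 * ‖E t‖ := by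
    intro κ hb t
    have h := one_add_le _ (hb t)
    calc ‖N κ t‖ ≤ ‖1 + κ t‖ * ‖E t‖ * ‖1 + κ t‖ := norm_mul₃_le
      _ ≤ 2 * ‖E t‖ * 2 := by gcongr
      _ = _ := by ring
  -- Integrating from infinity turns the Riccati equation into `κ = T κ`. On the unit ball `‖1 + κ‖
  -- ≤ 2`, so both the size and the Lipschitz constant of `T` are at most `4θ ≤ 1/2`.
  set T : (ℝ → A) → ℝ → A := fun κ x => -tailIntegral ρ (N κ) (max x 0) with hT
  have hTc : ∀ κ : ℝ → A, Continuous κ → (∀ x, ‖κ x‖ ≤ 1) → Continuous (T κ) :=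
    fun κ hc hb => ((isPrimitive_tailIntegral hρ (hNi κ hc hb)).continuousOn.neg).comp_continuous
      (f := fun x : ℝ => max x 0) (by fun_prop) (fun x => le_max_right x 0)
  have hTb : ∀ κ : ℝ → A, (∀ x, ‖κ x‖ ≤ 1) → ∀ x, ‖T κ x‖ ≤ 4 * θ := fun κ hb x => by
    rw [hT, norm_neg]
    exact tail_le _ 4 (by norm_num) (hNb κ hb) _ (le_max_right x 0)
  let S := Metric.closedBall (0 : BoundedContinuousFunction ℝ A) 1
  have hS : ∀ κ : S, ∀ x, ‖(κ : BoundedContinuousFunction ℝ A) x‖ ≤ 1 := fun κ x =>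
    (κ.1.norm_coe_le_norm x).trans (mem_closedBall_zero_iff.1 κ.2)
  let Φ : S → S := fun κ =>
    ⟨BoundedContinuousFunction.ofNormedAddCommGroup (T κ.1) (hTc _ κ.1.continuous (hS κ)) (4 * θ)
      (hTb _ (hS κ)), by
      rw [mem_closedBall_zero_iff]
      exact (BoundedContinuousFunction.norm_ofNormedAddCommGroup_le _ (by positivity) _).trans
        (by linarith)⟩
  have hΦ : ContractingWith (1 / 2) Φ := by
    refine ⟨by norm_num, LipschitzWith.of_dist_le_mul fun κ κ' => ?_⟩
    rw [Subtype.dist_eq, BoundedContinuousFunction.dist_le (by positivity)]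
    intro x
    have h0 : 0 ≤ max x 0 := le_max_right x 0
    have hd : ∀ t, ‖κ.1 t - κ'.1 t‖ ≤ dist κ κ' := fun t => by
      rw [← dist_eq_norm]; exact BoundedContinuousFunction.dist_coe_le_dist t
    rw [dist_eq_norm]
    change ‖-tailIntegral ρ (N κ.1) (max x 0) - -tailIntegral ρ (N κ'.1) (max x 0)‖ ≤ _
    rw [neg_sub_neg, norm_sub_rev, tailIntegral_sub hρ (hNi _ κ.1.continuous (hS κ))
      (hNi _ κ'.1.continuous (hS κ')) h0]
    refine (tail_le _ (4 * dist κ κ') (by positivity) (fun t => ?_) _ h0).trans ?_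
    · have e1 : N κ.1 t - N κ'.1 t = (κ.1 t - κ'.1 t) * E t * (1 + κ.1 t) +
          (1 + κ'.1 t) * E t * (κ.1 t - κ'.1 t) := by
        simp only [hN]; noncomm_ring
      rw [e1]
      calc _ ≤ ‖κ.1 t - κ'.1 t‖ * ‖E t‖ * ‖1 + κ.1 t‖ +
            ‖1 + κ'.1 t‖ * ‖E t‖ * ‖κ.1 t - κ'.1 t‖ :=
            (norm_add_le _ _).trans (add_le_add norm_mul₃_le norm_mul₃_le)
        _ ≤ dist κ κ' * ‖E t‖ * 2 + 2 * ‖E t‖ * dist κ κ' := by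
            gcongr
            · exact hd t
            · exact one_add_le _ (hS κ t)
            · exact one_add_le _ (hS κ' t)
            · exact hd t
        _ = _ := by ring
    · have : 4 * dist κ κ' * θ ≤ 4 * dist κ κ' * (1 / 8) := by gcongr
      refine this.trans (le_of_eq ?_)
      simp
      ring
  have hScomplete : CompleteSpace S := Metric.isClosed_closedBall.completeSpace_coe
  obtain ⟨κ, hκ, -⟩ := hΦ.exists_fixedPoint ⟨0, by simp [S]⟩ (edist_ne_top _ _)
  have hfix : ∀ x, κ.1 x = -tailIntegral ρ (N κ.1) (max x 0) := fun x =>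
    (congrArg (fun f : S => f.1 x) hκ).symm
  refine ⟨κ.1, κ.1.continuous, hS κ, fun x _ => ?_, ?_⟩
  · rw [hfix x]
    exact hTb _ (hS κ) x
  · refine ((IsPrimitive.const (0 : A)).sub
      (isPrimitive_tailIntegral hρ (hNi _ κ.1.continuous (hS κ)))).congr (fun x hx => ?_)
      (ae_of_all _ fun x hx => ?_)
    · rw [hfix x, max_eq_left hx, zero_sub]
    · rw [hfix x, max_eq_left hx.le, smul_neg, zero_sub, neg_sub, sub_eq_add_neg, add_comm]
      congr 1
      change _ = N κ.1 x
      simp only [hN]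
      rw [hfix x, max_eq_left hx.le]

end Riccati

/-! ### Grönwall's bound with a damping term. -/

section Damped

variable {E : Type*} [NormedAddCommGroup E] [NormedSpace ℂ E] [CompleteSpace E]

/-- Variation of constants with `|exp(c(s - t))| ≤ 1` for `t ≤ s`. The bound does not involve `c`,
which makes it uniform in the spectral parameter. -/
theorem IsPrimitive.norm_le_of_damped {y b : ℝ → E} {c : ℂ}
    (hy : IsPrimitive y (fun t => c • y t + b t)) (hc : c.re ≤ 0) {g k : ℝ → ℝ} {x : ℝ}
    (hx : 0 ≤ x) (hg : IntervalIntegrable g volume 0 x) (hg0 : ∀ t, 0 ≤ g t)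
    (hk : ∀ x, 0 ≤ x → IntervalIntegrable k volume 0 x) (hk0 : ∀ t, 0 ≤ k t)
    (hb : ∀ t, 0 ≤ t → t ≤ x → ‖b t‖ ≤ g t + k t * ‖y t‖) :
    ‖y x‖ ≤ (‖y 0‖ + ∫ t in 0..x, g t) * Real.exp (∫ t in 0..x, k t) := by
  have hu := ((isPrimitive_cexp (-c)).smul hy).congr (g' := fun t => Complex.exp (-c * t) • b t)
    (fun _ _ => rfl) (ae_of_all _ fun t _ => by
      rw [smul_add, smul_smul, ← add_assoc, ← add_smul]
      ring_nf
      simp)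
  refine le_mul_exp_of_le_integral (f := fun s => ‖y s‖) hy.continuousOn.norm hk hk0
    (fun s hs hsx => ?_) hx le_rfl
  have hgs : IntervalIntegrable g volume 0 s :=
    hg.mono_set (by rw [uIcc_of_le hs, uIcc_of_le hx]; exact Icc_subset_Icc_right hsx)
  have hks : IntervalIntegrable (fun t => k t * ‖y t‖) volume 0 s :=
    (hk s hs).mul_continuousOn
      (hy.continuousOn.norm.mono (by rw [uIcc_of_le hs]; exact Icc_subset_Ici_self))
  have hnexp : ∀ r : ℝ, 0 ≤ r → ‖Complex.exp (c * r)‖ ≤ 1 := fun r hr => by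
    rw [Complex.norm_exp, Real.exp_le_one_iff]
    simpa using mul_nonpos_of_nonpos_of_nonneg hc hr
  have hys : y s = Complex.exp (c * s) • y 0 +
      ∫ t in 0..s, Complex.exp (c * (s - t : ℝ)) • b t := by
    have h := (hu s hs).2
    simp only [Complex.ofReal_zero, mul_zero, Complex.exp_zero, one_smul] at h
    calc y s = Complex.exp (c * s) • (Complex.exp (-c * s) • y s) := by
          rw [smul_smul, ← Complex.exp_add]; simp
      _ = _ := by
          rw [h, smul_add, ← intervalIntegral.integral_smul]
          congr 2
          ext t
          rw [smul_smul, ← Complex.exp_add]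
          congr 2
          push_cast
          ring
  calc ‖y s‖ ≤ ‖y 0‖ + ∫ t in 0..s, (g t + k t * ‖y t‖) := by
        rw [hys]
        refine (norm_add_le _ _).trans (add_le_add ?_ ?_)
        · rw [norm_smul]
          exact mul_le_of_le_one_left (norm_nonneg _) (hnexp s hs)
        · refine intervalIntegral.norm_integral_le_of_norm_le hs (ae_of_all _ fun t ht => ?_)
            (hgs.add hks)
          rw [norm_smul]
          exact (mul_le_of_le_one_left (norm_nonneg _) (hnexp _ (sub_nonneg.2 ht.2))).trans
            (hb t ht.1.le (ht.2.trans hsx))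
    _ = ‖y 0‖ + (∫ t in 0..s, g t) + ∫ t in 0..s, k t * ‖y t‖ := by
        rw [intervalIntegral.integral_add hgs hks, add_assoc]
    _ ≤ _ := by
        gcongr
        exact intervalIntegral.integral_mono_interval le_rfl hs hsx (ae_of_all _ hg0) hg

end Damped

/-! ### Matrices over a Banach algebra as a Banach algebra. -/

/-- Square matrices over a normed ring, normed by the operator norm for the sup norm. -/
def NormedMatrix (n A : Type*) := Matrix n n A

namespace NormedMatrix

variable {n A : Type*} [Fintype n] [DecidableEq n] [NormedRing A]

noncomputable instance : NormedRing (NormedMatrix n A) := Matrix.linftyOpNormedRing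

noncomputable instance [NormedAlgebra ℂ A] : NormedAlgebra ℂ (NormedMatrix n A) :=
  Matrix.linftyOpNormedAlgebra

instance [CompleteSpace A] : CompleteSpace (NormedMatrix n A) :=
  inferInstanceAs (CompleteSpace (Matrix n n A))

theorem norm_entry_le (X : Matrix n n A) (i j : n) : ‖X i j‖ ≤ @norm (NormedMatrix n A) _ X := by
  have h : @norm (NormedMatrix n A) _ X = ((Finset.univ.sup fun i => ∑ j, ‖X i j‖₊ : NNReal) : ℝ) :=
    Matrix.linfty_opNorm_def X
  rw [h, ← coe_nnnorm, NNReal.coe_le_coe]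
  exact (Finset.single_le_sum (f := fun j => ‖X i j‖₊) (fun _ _ => zero_le)
    (Finset.mem_univ j)).trans
    (Finset.le_sup (f := fun i => ∑ j, ‖X i j‖₊) (Finset.mem_univ i))

theorem norm_single_le (i j : n) (a : A) :
    @norm (NormedMatrix n A) _ (Matrix.single i j a) ≤ ‖a‖ := by
  have h : @norm (NormedMatrix n A) _ (Matrix.single i j a) =
      ((Finset.univ.sup fun k => ∑ l, ‖Matrix.single i j a k l‖₊ : NNReal) : ℝ) :=
    Matrix.linfty_opNorm_def _
  rw [h, ← coe_nnnorm, NNReal.coe_le_coe]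
  refine Finset.sup_le fun k _ => ?_
  by_cases hk : i = k
  · subst hk
    refine (Finset.sum_eq_single j (fun l _ hl => ?_) (by simp)).le.trans ?_
    · simp [hl.symm]
    · simp
  · simp [hk]

/-- A `2 × 2` matrix given by its coefficients. -/
def mk₂ (a b c d : A) : NormedMatrix (Fin 2) A := !![a, b; c, d]

section

variable (a b c d a' b' c' d' : A)

theorem mk₂_mul : mk₂ a b c d * mk₂ a' b' c' d' =
    mk₂ (a * a' + b * c') (a * b' + b * d') (c * a' + d * c') (c * b' + d * d') :=
  Matrix.mul_fin_two ..

theorem mk₂_sub : mk₂ a b c d - mk₂ a' b' c' d' = mk₂ (a - a') (b - b') (c - c') (d - d') := by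
  change (_ : Matrix (Fin 2) (Fin 2) A) = _
  ext i j
  fin_cases i <;> fin_cases j <;> rfl

theorem mk₂_add : mk₂ a b c d + mk₂ a' b' c' d' = mk₂ (a + a') (b + b') (c + c') (d + d') := by
  change (_ : Matrix (Fin 2) (Fin 2) A) = _
  ext i j
  fin_cases i <;> fin_cases j <;> rfl

theorem one_eq_mk₂ : (1 : NormedMatrix (Fin 2) A) = mk₂ 1 0 0 1 := Matrix.one_fin_two

end

variable [NormedAlgebra ℂ A]

/-- The coefficient of a matrix as a continuous linear map. -/
noncomputable def entry (i j : n) : NormedMatrix n A →L[ℂ] A :=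
  LinearMap.mkContinuous (E := NormedMatrix n A) (Matrix.entryLinearMap ℂ A i j) 1
    fun X => by rw [one_mul]; exact norm_entry_le X i j

/-- The embedding into a coefficient as a continuous linear map. -/
noncomputable def single (i j : n) : A →L[ℂ] NormedMatrix n A :=
  LinearMap.mkContinuous (F := NormedMatrix n A) (Matrix.singleLinearMap ℂ i j) 1
    fun a => by rw [one_mul]; exact norm_single_le i j a

section mk₂

variable (a b c d : A)

@[simp] theorem entry_mk₂_zero_one : entry 0 1 (mk₂ a b c d) = b := rfl
@[simp] theorem entry_mk₂_one_zero : entry 1 0 (mk₂ a b c d) = c := rfl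

theorem eq_mk₂ (X : NormedMatrix (Fin 2) A) :
    X = mk₂ (entry 0 0 X) (entry 0 1 X) (entry 1 0 X) (entry 1 1 X) :=
  Matrix.eta_fin_two _

theorem smul_mk₂ (z : ℂ) : z • mk₂ a b c d = mk₂ (z • a) (z • b) (z • c) (z • d) := by
  change (_ : Matrix (Fin 2) (Fin 2) A) = _
  ext i j
  fin_cases i <;> fin_cases j <;> rfl

theorem mk₂_eq_sum_single : mk₂ a b c d =
    single 0 0 a + single 0 1 b + (single 1 0 c + single 1 1 d) := by
  have h₁ : single 0 0 a = mk₂ a 0 0 0 := by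
    change (Matrix.single 0 0 a : Matrix (Fin 2) (Fin 2) A) = !![a, 0; 0, 0]
    ext i j
    fin_cases i <;> fin_cases j <;> simp
  have h₂ : single 0 1 b = mk₂ 0 b 0 0 := by
    change (Matrix.single 0 1 b : Matrix (Fin 2) (Fin 2) A) = !![0, b; 0, 0]
    ext i j
    fin_cases i <;> fin_cases j <;> simp
  have h₃ : single 1 0 c = mk₂ 0 0 c 0 := by
    change (Matrix.single 1 0 c : Matrix (Fin 2) (Fin 2) A) = !![0, 0; c, 0]
    ext i j
    fin_cases i <;> fin_cases j <;> simp
  have h₄ : single 1 1 d = mk₂ 0 0 0 d := by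
    change (Matrix.single 1 1 d : Matrix (Fin 2) (Fin 2) A) = !![0, 0; 0, d]
    ext i j
    fin_cases i <;> fin_cases j <;> simp
  rw [h₁, h₂, h₃, h₄]
  simp only [mk₂_add, add_zero, zero_add]

end mk₂

end NormedMatrix

open NormedMatrix

/-! ### Triangularization of the first-order system. -/

section TwoByTwo

variable {A : Type*} [NormedRing A] [NormedAlgebra ℂ A]

theorem IsPrimitive.clmComplex {E F : Type*} [NormedAddCommGroup E] [NormedSpace ℂ E]
    [CompleteSpace E] [NormedAddCommGroup F] [NormedSpace ℂ F] [CompleteSpace F] {f f' : ℝ → E}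
    (hf : IsPrimitive f f') (L : E →L[ℂ] F) :
    IsPrimitive (fun x => L (f x)) (fun x => L (f' x)) :=
  hf.clm (L.restrictScalars ℝ)

theorem IsPrimitive.mk₂ [CompleteSpace A] {a a' b b' c c' d d' : ℝ → A} (ha : IsPrimitive a a')
    (hb : IsPrimitive b b') (hc : IsPrimitive c c') (hd : IsPrimitive d d') :
    IsPrimitive (fun x => mk₂ (a x) (b x) (c x) (d x))
      (fun x => mk₂ (a' x) (b' x) (c' x) (d' x)) := by
  simp only [mk₂_eq_sum_single]
  exact ((ha.clmComplex _).add (hb.clmComplex _)).add ((hc.clmComplex _).add (hd.clmComplex _))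

theorem IntervalIntegrable.clm {E F : Type*} [NormedAddCommGroup E] [NormedSpace ℂ E]
    [NormedAddCommGroup F] [NormedSpace ℂ F] {f : ℝ → E} {x y : ℝ}
    (hf : IntervalIntegrable f volume x y) (L : E →L[ℂ] F) :
    IntervalIntegrable (fun t => L (f t)) volume x y :=
  ⟨L.integrable_comp hf.1, L.integrable_comp hf.2⟩

theorem IntervalIntegrable.mk₂ {a b c d : ℝ → A} {x y : ℝ}
    (ha : IntervalIntegrable a volume x y) (hb : IntervalIntegrable b volume x y)
    (hc : IntervalIntegrable c volume x y) (hd : IntervalIntegrable d volume x y) :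
    IntervalIntegrable (fun x => mk₂ (a x) (b x) (c x) (d x)) volume x y := by
  simp only [mk₂_eq_sum_single]
  exact ((ha.clm _).add (hb.clm _)).add ((hc.clm _).add (hd.clm _))

/-- The coefficient matrix of the first-order system for `(Y, Y' - (c / 2) Y)`, `c = 2 i ρ`. -/
noncomputable def systemMatrix (c : ℂ) (q : A) : NormedMatrix (Fin 2) A :=
  mk₂ ((c / 2) • 1) 1 (-q) (-((c / 2) • 1))

/-- The change of coordinates that makes the system triangular. -/
noncomputable def triangularization (c : ℂ) (κ : A) : NormedMatrix (Fin 2) A :=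
  mk₂ (1 + κ) 1 (-(c • κ)) (-(c • 1))

/-- The inverse of `triangularization`. -/
noncomputable def triangularizationInv (c : ℂ) (κ : A) : NormedMatrix (Fin 2) A :=
  mk₂ 1 (c⁻¹ • 1) (-κ) (-(c⁻¹ • (1 + κ)))

/-- The triangular form of the system. -/
noncomputable def triangularForm (c : ℂ) (E κ : A) : NormedMatrix (Fin 2) A :=
  mk₂ ((c / 2) • 1 - E * (1 + κ)) (-E) 0 (-((c / 2) • 1) + (1 + κ) * E)

variable {c : ℂ}

theorem triangularization_mul_inv (hc : c ≠ 0) (κ : A) :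
    triangularization c κ * triangularizationInv c κ = 1 := by
  rw [one_eq_mk₂, triangularization, triangularizationInv, mk₂_mul]
  congr 1 <;>
  simp only [mul_add, mul_neg, neg_mul, mul_one, one_mul, smul_mul_assoc, mul_smul_comm,
    smul_add] <;>
  match_scalars <;> (try field_simp) <;> ring

/-- If `κ` solves the Riccati equation, the right side is the derivative of `triangularization c κ`.
Thus `triangularization` is a gauge transformation from the triangular system to the original one,
and its first column spans the decaying solutions. -/
theorem system_mul_triangularization (E κ : A) :
    systemMatrix c (c • E) * triangularization c κ - triangularization c κ * triangularForm c E κ =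
      mk₂ (-c • κ + (1 + κ) * E * (1 + κ)) 0
        (-(c • (-c • κ + (1 + κ) * E * (1 + κ)))) 0 := by
  rw [systemMatrix, triangularForm, triangularization, mk₂_mul, mk₂_mul, mk₂_sub]
  congr 1 <;>
  simp only [mul_add, add_mul, mul_sub, mul_neg, neg_mul, mul_one, one_mul, mul_zero, neg_smul,
    smul_mul_assoc, mul_smul_comm, smul_add, smul_neg, mul_assoc] <;>
  module

theorem triangularForm_mul_inv (hc : c ≠ 0) (E κ : A) :
    triangularForm c E κ * triangularizationInv c κ -
        triangularizationInv c κ * systemMatrix c (c • E) =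
      mk₂ 0 0 (-(-c • κ + (1 + κ) * E * (1 + κ)))
        (-(c⁻¹ • (-c • κ + (1 + κ) * E * (1 + κ)))) := by
  rw [systemMatrix, triangularForm, triangularizationInv, mk₂_mul, mk₂_mul, mk₂_sub]
  congr 1 <;>
  simp only [mul_add, add_mul, mul_neg, neg_mul, mul_one, one_mul, neg_smul, smul_mul_assoc,
    mul_smul_comm, smul_add, smul_neg, mul_assoc] <;>
  match_scalars <;> (try field_simp) <;> ring

end TwoByTwo
open NormedMatrix

/-! ### Bounds for the transformation operator in triangular coordinates. -/

section TriangularBound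

theorem norm_one_add_le_two {A : Type*} [NormedRing A] [NormOneClass A] {a : A} (ha : ‖a‖ ≤ 1) :
    ‖1 + a‖ ≤ 2 :=
  (norm_add_le _ _).trans (by rw [norm_one]; linarith)

theorem IsPrimitive.const_smul {E : Type*} [NormedAddCommGroup E] [NormedSpace ℂ E]
    [CompleteSpace E] {f f' : ℝ → E} (hf : IsPrimitive f f') (c : ℂ) :
    IsPrimitive (fun x => c • f x) (fun x => c • f' x) :=
  hf.clmComplex (c • ContinuousLinearMap.id ℂ E)

theorem IsPrimitive.neg {E : Type*} [NormedAddCommGroup E] [NormedSpace ℝ E] {f f' : ℝ → E}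
    (hf : IsPrimitive f f') : IsPrimitive (fun x => -f x) (fun x => -f' x) := by
  simpa using (IsPrimitive.const 0).sub hf

variable {A : Type*} [NormedRing A] [NormedAlgebra ℂ A] {c : ℂ}
  {E F κ μ : ℝ → A} {P : ℝ → NormedMatrix (Fin 2) A}

/-- The derivative prescribed by the Riccati equation. -/
def riccatiField (c : ℂ) (E κ : A) : A := -c • κ + (1 + κ) * E * (1 + κ)

/-- For a triangular argument the parameter `c` cancels on the diagonal and survives only as `c • b`
in the upper corner, where it damps when `Re c ≤ 0`. -/
theorem triangularForm_mul_sub (E κ F μ a b d : A) :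
    triangularForm c E κ * mk₂ a b 0 d - mk₂ a b 0 d * triangularForm c F μ =
      mk₂ (-(E * (1 + κ) * a) + a * (F * (1 + μ)))
        (c • b + (-(E * (1 + κ) * b) - b * ((1 + μ) * F) + (-(E * d) + a * F))) 0
        ((1 + κ) * E * d - d * ((1 + μ) * F)) := by
  rw [triangularForm, triangularForm, mk₂_mul, mk₂_mul, mk₂_sub]
  congr 1 <;>
  simp only [mul_add, add_mul, mul_sub, sub_mul, mul_neg, neg_mul, mul_one, one_mul, mul_zero,
    zero_mul, smul_mul_assoc, mul_smul_comm, mul_assoc] <;>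
  module

/-- The lower corner obeys a closed homogeneous equation, so it vanishes identically once it
vanishes at `0`. Otherwise the term `-c • e` would make it grow. -/
theorem entry_one_zero_triangular (E κ F μ a b e d : A) :
    entry 1 0 (triangularForm c E κ * mk₂ a b e d - mk₂ a b e d * triangularForm c F μ) =
      -c • e + ((1 + κ) * E * e + e * (F * (1 + μ))) := by
  rw [triangularForm, triangularForm, mk₂_mul, mk₂_mul, mk₂_sub, entry_mk₂_one_zero]
  simp only [mul_add, add_mul, mul_sub, neg_mul, mul_one, one_mul, mul_zero, zero_mul,
    smul_mul_assoc, mul_smul_comm, mul_assoc]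
  module

/-- The value at `0` of the conjugated transformation operator. -/
theorem conj_initial (hc : c ≠ 0) (κ μ δ : A) :
    triangularizationInv c κ * mk₂ 1 0 δ 1 * triangularization c μ =
      mk₂ (1 + (c⁻¹ • δ) * (1 + μ)) (c⁻¹ • δ) (μ - κ - (1 + κ) * (c⁻¹ • δ) * (1 + μ))
        (1 - (1 + κ) * (c⁻¹ • δ)) := by
  rw [triangularizationInv, triangularization, mk₂_mul, mk₂_mul]
  congr 1 <;>
  simp only [mul_add, add_mul, mul_neg, neg_mul, mul_one, one_mul, mul_zero, smul_neg,
    smul_mul_assoc, mul_smul_comm, smul_add, mul_assoc, zero_add] <;>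
  match_scalars <;> (try field_simp) <;> ring

/-- The factor `c⁻¹` in front is the source of the decay of the corner as `ρ → ∞`. -/
theorem entry_zero_one_conj (hc : c ≠ 0) (κ μ a b d : A) (P : NormedMatrix (Fin 2) A)
    (h : triangularizationInv c κ * P * triangularization c μ = mk₂ a b 0 d) :
    entry 0 1 P = c⁻¹ • ((1 + κ) * a - ((1 + κ) * b + d) * (1 + μ)) := by
  have h1 : P = triangularization c κ * mk₂ a b 0 d * triangularizationInv c μ := by
    rw [← h]
    calc P = (triangularization c κ * triangularizationInv c κ) * P *
          (triangularization c μ * triangularizationInv c μ) := by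
          rw [triangularization_mul_inv hc, triangularization_mul_inv hc, one_mul, mul_one]
      _ = _ := by noncomm_ring
  rw [h1, triangularization, triangularizationInv, mk₂_mul, mk₂_mul, entry_mk₂_zero_one]
  simp only [mul_add, add_mul, mul_neg, mul_one, one_mul, mul_zero, smul_add, smul_sub, add_zero,
    mul_smul_comm]
  module

variable [CompleteSpace A]

theorem isPrimitive_triangularization
    (hκ : IsPrimitive κ (fun x => riccatiField c (E x) (κ x))) :
    IsPrimitive (fun x => triangularization c (κ x)) (fun x =>
      systemMatrix c (c • E x) * triangularization c (κ x) -
        triangularization c (κ x) * triangularForm c (E x) (κ x)) := by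
  simp only [system_mul_triangularization]
  refine (((IsPrimitive.const 1).add hκ).mk₂ (IsPrimitive.const 1) (hκ.const_smul c).neg
    (IsPrimitive.const (-(c • 1)))).congr (fun x _ => rfl) (ae_of_all _ fun x _ => ?_)
  rw [zero_add, riccatiField]

theorem isPrimitive_triangularizationInv (hc : c ≠ 0)
    (hκ : IsPrimitive κ (fun x => riccatiField c (E x) (κ x))) :
    IsPrimitive (fun x => triangularizationInv c (κ x)) (fun x =>
      triangularForm c (E x) (κ x) * triangularizationInv c (κ x) -
        triangularizationInv c (κ x) * systemMatrix c (c • E x)) := by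
  simp only [triangularForm_mul_inv hc]
  refine ((IsPrimitive.const 1).mk₂ (IsPrimitive.const (c⁻¹ • 1)) hκ.neg
    (((IsPrimitive.const 1).add hκ).const_smul c⁻¹).neg).congr (fun x _ => rfl)
    (ae_of_all _ fun x _ => ?_)
  rw [zero_add, riccatiField]

/-- Conjugation by the triangularizations turns the transformation operator equation into an
equation with triangular coefficients. -/
theorem isPrimitive_conj (hc : c ≠ 0) (hκ : IsPrimitive κ (fun x => riccatiField c (E x) (κ x)))
    (hμ : IsPrimitive μ (fun x => riccatiField c (F x) (μ x)))
    (hP : IsPrimitive P (fun x => systemMatrix c (c • E x) * P x -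
      P x * systemMatrix c (c • F x))) :
    IsPrimitive (fun x => triangularizationInv c (κ x) * P x * triangularization c (μ x))
      (fun x => triangularForm c (E x) (κ x) *
          (triangularizationInv c (κ x) * P x * triangularization c (μ x)) -
        (triangularizationInv c (κ x) * P x * triangularization c (μ x)) *
          triangularForm c (F x) (μ x)) := by
  refine (((isPrimitive_triangularizationInv hc hκ).mul hP).mul
    (isPrimitive_triangularization hμ)).congr (fun _ _ => rfl) (ae_of_all _ fun x _ => ?_)
  noncomm_ring

variable [NormOneClass A] in
/-- If the conjugated transformation operator is triangular at `0`, its corner is small. -/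
theorem norm_entry_zero_one_le (hc : c ≠ 0) (hcre : c.re ≤ 0)
    (hE : ∀ x, 0 ≤ x → IntervalIntegrable E volume 0 x)
    (hF : ∀ x, 0 ≤ x → IntervalIntegrable F volume 0 x)
    (hκ : IsPrimitive κ (fun x => riccatiField c (E x) (κ x)))
    (hμ : IsPrimitive μ (fun x => riccatiField c (F x) (μ x)))
    (hκ1 : ∀ x, ‖κ x‖ ≤ 1) (hμ1 : ∀ x, ‖μ x‖ ≤ 1)
    (hP : IsPrimitive P (fun x => systemMatrix c (c • E x) * P x - P x * systemMatrix c (c • F x)))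
    {δ : A} (hP0 : P 0 = mk₂ 1 0 δ 1) {D S : ℝ} (hδ : ‖c⁻¹ • δ‖ ≤ D)
    (h0 : μ 0 - κ 0 - (1 + κ 0) * (c⁻¹ • δ) * (1 + μ 0) = 0) {x : ℝ} (hx : 0 ≤ x)
    (hS : ∫ t in 0..x, (‖E t‖ + ‖F t‖) ≤ S) :
    ‖entry 0 1 (P x)‖ ≤ ‖c⁻¹‖ * (8 * (1 + 2 * D) * (1 + S) * Real.exp (4 * S)) := by
  set k : ℝ → ℝ := fun t => ‖E t‖ + ‖F t‖ with hk
  have hki : ∀ x, 0 ≤ x → IntervalIntegrable k volume 0 x := fun x hx =>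
    (hE x hx).norm.add (hF x hx).norm
  have hk2i : ∀ x, 0 ≤ x → IntervalIntegrable (fun t => 2 * k t) volume 0 x := fun x hx =>
    (hki x hx).const_mul 2
  have hk0 : ∀ t, 0 ≤ k t := fun t => by positivity
  have hk20 : ∀ t, 0 ≤ 2 * k t := fun t => mul_nonneg zero_le_two (hk0 t)
  have hI0 : ∀ s, 0 ≤ s → 0 ≤ ∫ t in 0..s, k t := fun s hs =>
    intervalIntegral.integral_nonneg hs fun t _ => hk0 t
  have hS0 : 0 ≤ S := (hI0 x hx).trans hS
  have hD0 : 0 ≤ D := (norm_nonneg _).trans hδ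
  have hIs : ∀ s, 0 ≤ s → s ≤ x → ∫ t in 0..s, 2 * k t ≤ 2 * S := fun s hs hsx => by
    rw [intervalIntegral.integral_const_mul]
    have := intervalIntegral.integral_mono_interval (le_refl (0 : ℝ)) hs hsx (ae_of_all _ hk0)
      (hki x hx)
    linarith
  have hmulE : ∀ t a b, ‖a‖ ≤ 1 → ‖E t * (1 + a) * b‖ ≤ 2 * ‖E t‖ * ‖b‖ := fun t a b ha => by
    have := norm_one_add_le_two ha
    calc _ ≤ ‖E t‖ * ‖1 + a‖ * ‖b‖ := norm_mul₃_le
      _ ≤ ‖E t‖ * 2 * ‖b‖ := by gcongr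
      _ = _ := by ring
  have hmulE' : ∀ t a b, ‖a‖ ≤ 1 → ‖(1 + a) * E t * b‖ ≤ 2 * ‖E t‖ * ‖b‖ := fun t a b ha => by
    have := norm_one_add_le_two ha
    calc _ ≤ ‖1 + a‖ * ‖E t‖ * ‖b‖ := norm_mul₃_le
      _ ≤ 2 * ‖E t‖ * ‖b‖ := by gcongr
  have hmulF : ∀ t a b, ‖a‖ ≤ 1 → ‖b * (F t * (1 + a))‖ ≤ 2 * ‖F t‖ * ‖b‖ := fun t a b ha => by
    have := norm_one_add_le_two ha
    rw [← mul_assoc]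
    calc _ ≤ ‖b‖ * ‖F t‖ * ‖1 + a‖ := norm_mul₃_le
      _ ≤ ‖b‖ * ‖F t‖ * 2 := by gcongr
      _ = _ := by ring
  have hmulF' : ∀ t a b, ‖a‖ ≤ 1 → ‖b * ((1 + a) * F t)‖ ≤ 2 * ‖F t‖ * ‖b‖ := fun t a b ha => by
    have := norm_one_add_le_two ha
    rw [← mul_assoc]
    calc _ ≤ ‖b‖ * ‖1 + a‖ * ‖F t‖ := norm_mul₃_le
      _ ≤ ‖b‖ * 2 * ‖F t‖ := by gcongr
      _ = _ := by ring
  set N : ℝ → NormedMatrix (Fin 2) A := fun x =>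
    triangularizationInv c (κ x) * P x * triangularization c (μ x) with hN
  have hNP : IsPrimitive N _ := isPrimitive_conj hc hκ hμ hP
  have hN0 := conj_initial hc (κ 0) (μ 0) δ
  rw [← hP0, h0] at hN0
  change N 0 = _ at hN0
  set n := fun (i j : Fin 2) (x : ℝ) => entry i j (N x) with hn
  have hNn : ∀ x, N x = mk₂ (n 0 0 x) (n 0 1 x) (n 1 0 x) (n 1 1 x) := fun x => eq_mk₂ (N x)
  -- Only vanishing is wanted, so no uniformity in `c` matters and `-c • n 1 0` may go into the
  -- kernel through `‖c‖`.
  have h10 : ∀ s, 0 ≤ s → n 1 0 s = 0 := by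
    intro s hs
    have h := hNP.clmComplex (entry 1 0)
    have h' : IsPrimitive (n 1 0) (fun t => (0 : ℂ) • n 1 0 t + (-c • n 1 0 t +
        ((1 + κ t) * E t * n 1 0 t + n 1 0 t * (F t * (1 + μ t))))) := by
      refine h.congr (fun _ _ => rfl) (ae_of_all _ fun t _ => ?_)
      change _ = entry 1 0 (triangularForm c (E t) (κ t) * N t - N t * triangularForm c (F t) (μ t))
      rw [hNn t, entry_one_zero_triangular, zero_smul, zero_add]
    have hb := h'.norm_le_of_damped le_rfl (g := fun _ => 0) (k := fun t => ‖c‖ + 2 * k t) hs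
      intervalIntegrable_const (fun _ => le_rfl)
      (fun x hx => intervalIntegrable_const.add (hk2i x hx))
      (fun t => add_nonneg (norm_nonneg c) (hk20 t)) fun t _ _ => by
        refine (norm_add_le _ _).trans ?_
        have e1 := hmulE' t (κ t) (n 1 0 t) (hκ1 t)
        have e2 := hmulF t (μ t) (n 1 0 t) (hμ1 t)
        have e3 := norm_add_le ((1 + κ t) * E t * n 1 0 t) (n 1 0 t * (F t * (1 + μ t)))
        rw [norm_smul, norm_neg, hk]
        linarith
    have hz : n 1 0 0 = 0 := by simp only [hn]; rw [hN0]; rfl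
    simpa [hz] using hb
  have hNn' : ∀ s, 0 ≤ s → N s = mk₂ (n 0 0 s) (n 0 1 s) 0 (n 1 1 s) := fun s hs => by
    rw [hNn s, h10 s hs]
  replace hNP := hNP.congr (fun _ _ => rfl) (ae_of_all _ fun t ht => by
    change _ = triangularForm c (E t) (κ t) * N t - N t * triangularForm c (F t) (μ t)
    rw [hNn' t ht.le])
  -- Common bound of the diagonal entries: their values at `0` are at most `1 + 2D` by
  -- `conj_initial`, and the kernel `2(‖E‖ + ‖F‖)` has integral at most `2S`.
  set M := (1 + 2 * D) * Real.exp (2 * S) with hM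
  have hM0 : 0 ≤ M := by positivity
  have h00 : ∀ s, 0 ≤ s → s ≤ x → ‖n 0 0 s‖ ≤ M := by
    intro s hs hsx
    have h' : IsPrimitive (n 0 0) (fun t => (0 : ℂ) • n 0 0 t +
        (-(E t * (1 + κ t) * n 0 0 t) + n 0 0 t * (F t * (1 + μ t)))) := by
      have h := hNP.clmComplex (entry 0 0)
      simp only [triangularForm_mul_sub] at h
      simp only [zero_smul, zero_add]
      exact h
    have hb := h'.norm_le_of_damped le_rfl (g := fun _ => 0) (k := fun t => 2 * k t) hs
      intervalIntegrable_const (fun _ => le_rfl) hk2i hk20 fun t _ _ => by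
        refine (norm_add_le _ _).trans ?_
        have e1 := hmulE t (κ t) (n 0 0 t) (hκ1 t)
        have e2 := hmulF t (μ t) (n 0 0 t) (hμ1 t)
        rw [norm_neg, hk]
        linarith
    refine hb.trans ?_
    have hz : n 0 0 0 = 1 + (c⁻¹ • δ) * (1 + μ 0) := by simp only [hn]; rw [hN0]; rfl
    rw [hz, intervalIntegral.integral_zero, add_zero, hM]
    gcongr
    · refine (norm_add_le _ _).trans ?_
      rw [norm_one, mul_comm 2]
      gcongr
      exact (norm_mul_le _ _).trans
        (mul_le_mul hδ (norm_one_add_le_two (hμ1 0)) (norm_nonneg _) hD0)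
    · exact hIs s hs hsx
  have h11 : ∀ s, 0 ≤ s → s ≤ x → ‖n 1 1 s‖ ≤ M := by
    intro s hs hsx
    have h' : IsPrimitive (n 1 1) (fun t => (0 : ℂ) • n 1 1 t +
        ((1 + κ t) * E t * n 1 1 t - n 1 1 t * ((1 + μ t) * F t))) := by
      have h := hNP.clmComplex (entry 1 1)
      simp only [triangularForm_mul_sub] at h
      simp only [zero_smul, zero_add]
      exact h
    have hb := h'.norm_le_of_damped le_rfl (g := fun _ => 0) (k := fun t => 2 * k t) hs
      intervalIntegrable_const (fun _ => le_rfl) hk2i hk20 fun t _ _ => by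
        refine (norm_sub_le _ _).trans ?_
        have e1 := hmulE' t (κ t) (n 1 1 t) (hκ1 t)
        have e2 := hmulF' t (μ t) (n 1 1 t) (hμ1 t)
        rw [hk]
        linarith
    refine hb.trans ?_
    have hz : n 1 1 0 = 1 - (1 + κ 0) * (c⁻¹ • δ) := by simp only [hn]; rw [hN0]; rfl
    rw [hz, intervalIntegral.integral_zero, add_zero, hM]
    gcongr
    · refine (norm_sub_le _ _).trans ?_
      rw [norm_one]
      gcongr
      exact (norm_mul_le _ _).trans
        (mul_le_mul (norm_one_add_le_two (hκ1 0)) hδ (norm_nonneg _) zero_le_two)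
    · exact hIs s hs hsx
  -- Here the damping by `c` is used. The diagonal entries act as a forcing bounded by `M (‖E‖ +
  -- ‖F‖)`.
  have h01 : ‖n 0 1 x‖ ≤ (D + M * S) * Real.exp (2 * S) := by
    have h' : IsPrimitive (n 0 1) (fun t => c • n 0 1 t +
        (-(E t * (1 + κ t) * n 0 1 t) - n 0 1 t * ((1 + μ t) * F t) +
          (-(E t * n 1 1 t) + n 0 0 t * F t))) := by
      have h := hNP.clmComplex (entry 0 1)
      simp only [triangularForm_mul_sub] at h
      exact h
    have hb := h'.norm_le_of_damped hcre (g := fun t => M * k t) (k := fun t => 2 * k t) hx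
      ((hki x hx).const_mul M) (fun t => mul_nonneg hM0 (hk0 t)) hk2i hk20 fun t ht htx => by
        have e1 := hmulE t (κ t) (n 0 1 t) (hκ1 t)
        have e2 := hmulF' t (μ t) (n 0 1 t) (hμ1 t)
        have e3 := norm_sub_le (-(E t * (1 + κ t) * n 0 1 t)) (n 0 1 t * ((1 + μ t) * F t))
        have e4 := norm_add_le (-(E t * n 1 1 t)) (n 0 0 t * F t)
        have e5 : ‖E t * n 1 1 t‖ ≤ M * ‖E t‖ := (norm_mul_le _ _).trans
          (by rw [mul_comm M]; exact mul_le_mul_of_nonneg_left (h11 t ht htx) (norm_nonneg _))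
        have e6 : ‖n 0 0 t * F t‖ ≤ M * ‖F t‖ := (norm_mul_le _ _).trans
          (mul_le_mul_of_nonneg_right (h00 t ht htx) (norm_nonneg _))
        refine (norm_add_le _ _).trans ?_
        rw [norm_neg] at e3 e4
        rw [hk]
        linarith
    refine hb.trans ?_
    have hz : n 0 1 0 = c⁻¹ • δ := by simp only [hn]; rw [hN0]; rfl
    rw [hz, intervalIntegral.integral_const_mul]
    gcongr
    exact hIs x hx le_rfl
  rw [entry_zero_one_conj hc (κ x) (μ x) _ _ _ _ (hNn' x hx), norm_smul]
  gcongr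
  have hκx := norm_one_add_le_two (hκ1 x)
  have hμx := norm_one_add_le_two (hμ1 x)
  have h00x := h00 x hx le_rfl
  have h11x := h11 x hx le_rfl
  calc _ ≤ ‖1 + κ x‖ * ‖n 0 0 x‖ + (‖1 + κ x‖ * ‖n 0 1 x‖ + ‖n 1 1 x‖) * ‖1 + μ x‖ := by
        refine (norm_sub_le _ _).trans (add_le_add (norm_mul_le _ _) ((norm_mul_le _ _).trans ?_))
        gcongr
        exact (norm_add_le _ _).trans (add_le_add (norm_mul_le _ _) le_rfl)
    _ ≤ 2 * M + (2 * ((D + M * S) * Real.exp (2 * S)) + M) * 2 := by gcongr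
    _ ≤ _ := by
        have e1 : Real.exp (4 * S) = Real.exp (2 * S) * Real.exp (2 * S) := by
          rw [← Real.exp_add]; ring_nf
        have e2 : 1 ≤ Real.exp (2 * S) := Real.one_le_exp (by positivity)
        rw [hM, e1]
        set e := Real.exp (2 * S)
        have a1 : 0 ≤ (1 + 2 * D) * (e * (e - 1)) :=
          mul_nonneg (by positivity) (mul_nonneg (by positivity) (by linarith))
        have a2 : 0 ≤ (1 + 2 * D) * S * (e * e) := by positivity
        have a3 : 0 ≤ (1 + D) * (e * (e - 1)) :=
          mul_nonneg (by positivity) (mul_nonneg (by positivity) (by linarith))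
        have a4 : 0 ≤ (1 + D) * e := by positivity
        nlinarith

end TriangularBound

/-! ### Left and right multiplication as Volterra coefficients. -/

section Multiplication

variable {R : Type*} [NormedRing R] [NormedAlgebra ℂ R]

theorem isVolterra_mulLeft_sub_mulRight {a b : ℝ → R}
    (ha : ∀ x, 0 ≤ x → IntervalIntegrable a volume 0 x)
    (hb : ∀ x, 0 ≤ x → IntervalIntegrable b volume 0 x) :
    IsVolterra (fun t => LinearMap.mulLeft ℂ (a t) - LinearMap.mulRight ℂ (b t))
      (fun t => ‖a t‖ + ‖b t‖) where
  integrable x hx := (ha x hx).norm.add (hb x hx).norm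
  bound t y := by
    rw [LinearMap.sub_apply, LinearMap.mulLeft_apply, LinearMap.mulRight_apply, add_mul]
    refine (norm_sub_le _ _).trans (add_le_add (norm_mul_le _ _) ?_)
    rw [mul_comm ‖b t‖]
    exact norm_mul_le _ _
  nonneg t := by positivity
  measurable y hy x hx := by
    simp only [LinearMap.sub_apply, LinearMap.mulLeft_apply, LinearMap.mulRight_apply]
    have hy' : AEStronglyMeasurable y (volume.restrict (Ioc 0 x)) :=
      (hy.mono (Ioc_subset_Icc_self.trans Icc_subset_Ici_self)).aestronglyMeasurable
        measurableSet_Ioc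
    exact ((ha x hx).1.aestronglyMeasurable.mul hy').sub (hy'.mul (hb x hx).1.aestronglyMeasurable)

end Multiplication

/-! ### Construction of Weyl solutions for large `ρ` in a sector. -/

section Weyl

variable {A : Type*} [NormedRing A] [NormedAlgebra ℂ A]

/-- `a` is the value at `0` of a solution of `Y'' = ((c / 2)² - q) Y` that satisfies
`Y'(0) + h Y(0) = 1` and `Y(x) = O(exp(c x / 2))`. -/
def IsWeylValue (c : ℂ) (q : ℝ → A) (h a : A) : Prop :=
  ∃ Y V : ℝ → A, IsPrimitive Y V ∧ IsPrimitive V (fun x => (c / 2) ^ 2 • Y x - q x * Y x) ∧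
    V 0 + h * Y 0 = 1 ∧ (∃ K, ∀ x, 0 ≤ x → ‖Y x‖ ≤ K * ‖Complex.exp (c / 2 * x)‖) ∧ Y 0 = a

/-- The value of the boundary form on the decaying solution. -/
noncomputable def boundaryValue (c : ℂ) (h κ : A) : A := (c / 2) • (1 - κ) + h * (1 + κ)

/-- The expression is the lower corner in `conj_initial`. With equal Weyl values, subtracting the
two boundary conditions expresses `(g - h)` applied to the common value through `C` and `D`. The
commutation of `1 + κ` with `1 - κ` then cancels everything after multiplication by `D`, which is
invertible. -/
theorem triangular_initial {c : ℂ} (hc : c ≠ 0) {h g κ μ C D : A} (hC : boundaryValue c h κ * C = 1)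
    (hD : boundaryValue c g μ * D = 1) (hD' : D * boundaryValue c g μ = 1)
    (hCD : (1 + κ) * C = (1 + μ) * D) :
    μ - κ - (1 + κ) * (c⁻¹ • (g - h)) * (1 + μ) = 0 := by
  have h1 : (c / 2) • ((1 - κ) * C) + h * ((1 + μ) * D) = 1 := by
    rw [← hCD]
    simpa only [boundaryValue, add_mul, smul_mul_assoc, mul_assoc] using hC
  have h2 : (c / 2) • ((1 - μ) * D) + g * ((1 + μ) * D) = 1 := by
    simpa only [boundaryValue, add_mul, smul_mul_assoc, mul_assoc] using hD
  have e1 : (g - h) * ((1 + μ) * D) = (c / 2) • ((1 - κ) * C) - (c / 2) • ((1 - μ) * D) := by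
    rw [sub_mul, sub_eq_sub_iff_add_eq_add, add_comm, h2, h1]
  have e2 : (1 + κ) * ((1 - κ) * C) = (1 - κ) * ((1 + μ) * D) := by
    rw [← hCD]; noncomm_ring
  have e3 : (μ - κ - (1 + κ) * (c⁻¹ • (g - h)) * (1 + μ)) * D = 0 := by
    calc _ = (μ - κ) * D - c⁻¹ • ((1 + κ) * ((g - h) * ((1 + μ) * D))) := by
          rw [sub_mul, mul_smul_comm, smul_mul_assoc, smul_mul_assoc]
          simp only [mul_assoc]
      _ = 0 := by
          rw [e1, mul_sub, mul_smul_comm, mul_smul_comm, e2]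
          simp only [add_mul, sub_mul, mul_add, mul_sub, one_mul]
          match_scalars <;> field_simp <;> ring
  calc _ = (μ - κ - (1 + κ) * (c⁻¹ • (g - h)) * (1 + μ)) * (D * boundaryValue c g μ) := by
        rw [hD', mul_one]
    _ = 0 := by rw [← mul_assoc, e3, zero_mul]

/-- The bounded part `q₁` gains `1 / (2 Im ρ) ≤ 1 / |ρ|` from the exponential, where the sector
enters. The integrable part `q₀` already carries the factor `1 / (2|ρ|)`. -/
theorem integral_exp_mul_le {q₀ q₁ : ℝ → A} (h₀ : IntegrableOn q₀ (Ioi 0))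
    {B : ℝ} (hB : ∀ x, 0 < x → ‖q₁ x‖ ≤ B) {ρ : ℂ} (hρ : 1 ≤ ‖ρ‖)
    (hs : ‖ρ‖ ≤ 2 * ρ.im) {x : ℝ} (hx : 0 ≤ x) :
    ∫ t in Ioi x, Real.exp (-2 * ρ.im * (t - x)) * ‖q₁ t + (2 * Complex.I * ρ)⁻¹ • q₀ t‖ ≤
      (B + ∫ t in Ioi 0, ‖q₀ t‖) / ‖ρ‖ := by
  have hρ0 : 0 < ‖ρ‖ := by linarith
  have him : 0 < ρ.im := by linarith
  have hB0 : 0 ≤ B := (norm_nonneg _).trans (hB 1 one_pos)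
  have hneg : -2 * ρ.im < 0 := by linarith
  have hc : ‖(2 * Complex.I * ρ)⁻¹‖ ≤ 1 / ‖ρ‖ := by
    rw [norm_inv, norm_mul, norm_mul, Complex.norm_I, Complex.norm_ofNat, one_div]
    exact inv_anti₀ hρ0 (by linarith)
  have hexp : ∀ t, Real.exp (-2 * ρ.im * (t - x)) =
      Real.exp (2 * ρ.im * x) * Real.exp (-2 * ρ.im * t) := fun t => by
    rw [← Real.exp_add]; ring_nf
  have hi1 : IntegrableOn (fun t => Real.exp (-2 * ρ.im * (t - x)) * B) (Ioi x) := by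
    simp only [hexp]
    exact ((integrableOn_exp_mul_Ioi hneg x).const_mul _).mul_const _
  have hi2 : IntegrableOn (fun t => 1 / ‖ρ‖ * ‖q₀ t‖) (Ioi x) :=
    (h₀.mono_set (Ioi_subset_Ioi hx)).norm.const_mul _
  have hI1 : ∫ t in Ioi x, Real.exp (-2 * ρ.im * (t - x)) * B = B / (2 * ρ.im) := by
    simp only [hexp]
    rw [integral_mul_const, integral_const_mul, integral_exp_mul_Ioi hneg, ← mul_div_assoc,
      mul_neg, ← Real.exp_add]
    have : 2 * ρ.im * x + -2 * ρ.im * x = 0 := by ring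
    rw [this, Real.exp_zero]
    field_simp
  calc _ ≤ ∫ t in Ioi x, (Real.exp (-2 * ρ.im * (t - x)) * B + 1 / ‖ρ‖ * ‖q₀ t‖) := by
        refine integral_mono_of_nonneg (ae_of_all _ fun _ => by positivity) (hi1.add hi2) ?_
        refine (ae_restrict_mem measurableSet_Ioi).mono fun t ht => ?_
        have ht' : x < t := ht
        have e1 : Real.exp (-2 * ρ.im * (t - x)) ≤ 1 :=
          Real.exp_le_one_iff.2 (mul_nonpos_of_nonpos_of_nonneg hneg.le (by linarith))
        have e2 : ‖(2 * Complex.I * ρ)⁻¹ • q₀ t‖ ≤ 1 / ‖ρ‖ * ‖q₀ t‖ := by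
          rw [norm_smul]; gcongr
        have e3 := hB t (by linarith)
        beta_reduce
        calc _ ≤ Real.exp (-2 * ρ.im * (t - x)) * (B + 1 / ‖ρ‖ * ‖q₀ t‖) := by
              gcongr
              exact (norm_add_le _ _).trans (add_le_add e3 e2)
          _ ≤ _ := by
              rw [mul_add]
              exact add_le_add le_rfl (mul_le_of_le_one_left (by positivity) e1)
    _ = B / (2 * ρ.im) + 1 / ‖ρ‖ * ∫ t in Ioi x, ‖q₀ t‖ := by
        rw [integral_add hi1 hi2, hI1, integral_const_mul]
    _ ≤ B / ‖ρ‖ + 1 / ‖ρ‖ * ∫ t in Ioi 0, ‖q₀ t‖ := by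
        gcongr
        · exact ae_of_all _ fun _ => norm_nonneg _
        · exact h₀.norm
    _ = _ := by ring

variable [CompleteSpace A]

/-- The solution is `Y = exp(cx/2) (1 + κ) W` with derivative `(c/2) exp(cx/2) (1 - κ) W`, where `W'
= -E (1 + κ) W`. Integrability of `E` keeps `W` bounded. -/
theorem exists_decaying_solution [NormOneClass A] {c : ℂ} {E κ : ℝ → A}
    (hE : IntegrableOn E (Ioi 0))
    (hκ : IsPrimitive κ (fun x => riccatiField c (E x) (κ x))) (hκ1 : ∀ x, ‖κ x‖ ≤ 1)
    {h C : A} (hC : boundaryValue c h (κ 0) * C = 1) :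
    IsWeylValue c (fun x => c • E x) h ((1 + κ 0) * C) := by
  have hEi : ∀ x, 0 ≤ x → IntervalIntegrable E volume 0 x := fun x hx => by
    rw [intervalIntegrable_iff_integrableOn_Ioc_of_le hx]
    exact hE.mono_set Ioc_subset_Ioi_self
  have hai : ∀ x, 0 ≤ x → IntervalIntegrable (fun t => E t * (1 + κ t)) volume 0 x := fun x hx =>
    (hEi x hx).mul_continuousOn ((continuousOn_const.add hκ.continuousOn).mono
      (by rw [uIcc_of_le hx]; exact Icc_subset_Ici_self))
  obtain ⟨g, hg0, hg'⟩ := (isVolterra_mulLeft_sub_mulRight (fun x hx => (hai x hx).neg)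
    (b := fun _ => (0 : A)) (fun _ _ => intervalIntegrable_const)).exists_solution (1 : A)
  have hg : IsPrimitive g (fun t => -(E t * (1 + κ t) * g t)) :=
    hg'.congr (fun _ _ => rfl) (ae_of_all _ fun t _ => by simp [mul_assoc])
  set W : ℝ → A := fun x => g x * C with hW
  have hWP : IsPrimitive W (fun x => -(E x * (1 + κ x) * W x)) := by
    refine (hg.mul (IsPrimitive.const C)).congr (fun _ _ => rfl) (ae_of_all _ fun x _ => ?_)
    simp only [hW, neg_mul, mul_zero, add_zero, mul_assoc]
  have hexp := isPrimitive_cexp (c / 2)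
  refine ⟨fun x => Complex.exp (c / 2 * x) • ((1 + κ x) * W x),
    fun x => Complex.exp (c / 2 * x) • ((c / 2) • ((1 - κ x) * W x)), ?_, ?_, ?_, ?_, ?_⟩
  · refine (hexp.smul (((IsPrimitive.const 1).add hκ).mul hWP)).congr (fun _ _ => rfl)
      (ae_of_all _ fun x _ => ?_)
    simp only [riccatiField, add_mul, sub_mul, mul_add, mul_neg, one_mul, mul_one, zero_add,
      smul_mul_assoc, neg_smul, neg_mul, mul_assoc]
    module
  · refine (hexp.smul ((((IsPrimitive.const 1).sub hκ).mul hWP).const_smul (c / 2))).congr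
      (fun _ _ => rfl) (ae_of_all _ fun x _ => ?_)
    simp only [riccatiField, add_mul, sub_mul, mul_add, mul_neg, one_mul, mul_one, zero_sub,
      smul_mul_assoc, mul_smul_comm, neg_smul, neg_mul, mul_assoc]
    module
  · simp only [hW, hg0, one_mul, Complex.ofReal_zero, mul_zero, Complex.exp_zero, one_smul]
    simpa only [boundaryValue, add_mul, smul_mul_assoc, mul_assoc] using hC
  · refine ⟨2 * (Real.exp (∫ t in Ioi 0, 2 * ‖E t‖) * ‖C‖), fun x hx => ?_⟩
    have hb := IsPrimitive.norm_le_of_damped (c := 0) (b := fun t => -(E t * (1 + κ t) * g t))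
      (by simpa using hg) le_rfl (g := fun _ => 0) (k := fun t => 2 * ‖E t‖) hx
      intervalIntegrable_const (fun _ => le_rfl) (fun x hx => (hEi x hx).norm.const_mul 2)
      (fun _ => by positivity) fun t _ _ => by
        rw [norm_neg, zero_add]
        calc _ ≤ ‖E t‖ * ‖1 + κ t‖ * ‖g t‖ := norm_mul₃_le
          _ ≤ ‖E t‖ * 2 * ‖g t‖ := by gcongr; exact norm_one_add_le_two (hκ1 t)
          _ = _ := by ring
    rw [hg0, norm_one, intervalIntegral.integral_zero, add_zero, one_mul,
      intervalIntegral.integral_of_le hx] at hb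
    have hb' : ‖g x‖ ≤ Real.exp (∫ t in Ioi 0, 2 * ‖E t‖) := by
      refine hb.trans (Real.exp_le_exp.2 ?_)
      exact setIntegral_mono_set (hE.norm.const_mul 2) (ae_of_all _ fun _ => by positivity)
        (Ioc_subset_Ioi_self.eventuallyLE)
    rw [norm_smul, mul_comm]
    gcongr
    refine (norm_mul_le _ _).trans ?_
    gcongr
    · exact norm_one_add_le_two (hκ1 x)
    · exact (norm_mul_le _ _).trans (by gcongr)
  · simp [hW, hg0]

/-- The boundary value of the decaying solution is `iρ` times a perturbation of `1 + h₁'` of size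
`O(1/ρ)`, and the units are open. -/
theorem exists_riccati_isUnit [NormOneClass A] {q₀ q₁ : ℝ → A} (h₀ : IntegrableOn q₀ (Ioi 0))
    (h₁ : IntegrableOn q₁ (Ioi 0)) {B : ℝ} (hB : ∀ x, 0 < x → ‖q₁ x‖ ≤ B) {h₁' : A}
    (hu : IsUnit (1 + h₁')) (h₀' : A) :
    ∃ R : ℝ, 1 ≤ R ∧ ∀ ρ : ℂ, R ≤ ‖ρ‖ → ‖ρ‖ ≤ 2 * ρ.im → ∃ κ : ℝ → A, (∀ x, ‖κ x‖ ≤ 1) ∧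
      IsPrimitive κ (fun x => riccatiField (2 * Complex.I * ρ)
        (q₁ x + (2 * Complex.I * ρ)⁻¹ • q₀ x) (κ x)) ∧
      IsUnit (boundaryValue (2 * Complex.I * ρ) ((Complex.I * ρ) • h₁' + h₀') (κ 0)) := by
  set K₁ := B + ∫ t in Ioi 0, ‖q₀ t‖ with hK₁
  have hB0 : 0 ≤ B := (norm_nonneg _).trans (hB 1 one_pos)
  have hK₁0 : 0 ≤ K₁ := add_nonneg hB0 (integral_nonneg fun _ => norm_nonneg _)
  obtain ⟨ε, hε, hball⟩ := Metric.isOpen_iff.1 (Units.isOpen (R := A)) _ hu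
  set K₂ := 4 * K₁ * (1 + ‖h₁'‖) + 2 * ‖h₀'‖ with hK₂
  have hK₂0 : 0 ≤ K₂ := by positivity
  -- The three summands give `|ρ| ≥ 1`, the smallness `K₁ / |ρ| ≤ 1/8` required by `exists_riccati`,
  -- and `K₂ / |ρ| < ε`, the distance to `1 + h₁'` allowed by the ball of units.
  refine ⟨1 + 8 * K₁ + (K₂ + 1) / ε, ?_, fun ρ hR hs => ?_⟩
  · have : 0 ≤ (K₂ + 1) / ε := by positivity
    linarith
  have hε0 : 0 ≤ (K₂ + 1) / ε := by positivity
  have hρ1 : 1 ≤ ‖ρ‖ := by linarith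
  have hρ0 : 0 < ‖ρ‖ := by linarith
  have hρne : ρ ≠ 0 := norm_pos_iff.1 hρ0
  have him : 0 ≤ ρ.im := by linarith
  have hEint : IntegrableOn (fun x => q₁ x + (2 * Complex.I * ρ)⁻¹ • q₀ x) (Ioi 0) :=
    h₁.add (Integrable.smul (2 * Complex.I * ρ)⁻¹ h₀)
  obtain ⟨κ, -, hκ1, hκs, hκ⟩ := exists_riccati him hEint (θ := K₁ / ‖ρ‖)
    (fun x hx => integral_exp_mul_le h₀ hB hρ1 hs hx)
    (by rw [div_le_iff₀ hρ0]; linarith)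
  refine ⟨κ, hκ1, hκ.congr (fun _ _ => rfl) (ae_of_all _ fun x _ => ?_), ?_⟩
  · rw [riccatiField]
    congr 2
    ring
  set u : A := (1 - κ 0) + (h₁' + (Complex.I * ρ)⁻¹ • h₀') * (1 + κ 0) with hudef
  have hIρ : Complex.I * ρ ≠ 0 := mul_ne_zero Complex.I_ne_zero hρne
  have hbv : boundaryValue (2 * Complex.I * ρ) ((Complex.I * ρ) • h₁' + h₀') (κ 0) =
      algebraMap ℂ A (Complex.I * ρ) * u := by
    rw [← Algebra.smul_def, hudef, smul_add, ← smul_mul_assoc, smul_add, smul_inv_smul₀ hIρ,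
      boundaryValue]
    congr 2
    ring
  rw [hbv]
  refine ((isUnit_iff_ne_zero.2 hIρ).map (algebraMap ℂ A)).mul (hball ?_)
  rw [Metric.mem_ball, dist_eq_norm]
  have e0 : u - (1 + h₁') = (h₁' * κ 0 - κ 0) + ((Complex.I * ρ)⁻¹ • h₀') * (1 + κ 0) := by
    rw [hudef]; noncomm_ring
  have e1 : ‖κ 0‖ ≤ 4 * (K₁ / ‖ρ‖) := hκs 0 le_rfl
  have e2 : ‖((Complex.I * ρ)⁻¹ • h₀') * (1 + κ 0)‖ ≤ ‖ρ‖⁻¹ * ‖h₀'‖ * 2 := by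
    refine (norm_mul_le _ _).trans (mul_le_mul ?_ (norm_one_add_le_two (hκ1 0)) (norm_nonneg _)
      (by positivity))
    rw [norm_smul, norm_inv, norm_mul, Complex.norm_I, one_mul]
  calc ‖u - (1 + h₁')‖ ≤ (‖h₁'‖ * ‖κ 0‖ + ‖κ 0‖) + ‖ρ‖⁻¹ * ‖h₀'‖ * 2 := by
        rw [e0]
        refine (norm_add_le _ _).trans (add_le_add ((norm_sub_le _ _).trans
          (add_le_add_left (norm_mul_le _ _) _)) e2)
    _ ≤ (‖h₁'‖ * (4 * (K₁ / ‖ρ‖)) + 4 * (K₁ / ‖ρ‖)) + ‖ρ‖⁻¹ * ‖h₀'‖ * 2 := by gcongr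
    _ = K₂ / ‖ρ‖ := by rw [hK₂]; ring
    _ < ε := by
        rw [div_lt_iff₀ hρ0]
        have : (K₂ + 1) / ε ≤ ‖ρ‖ := by linarith
        rw [div_le_iff₀ hε] at this
        linarith

end Weyl

/-! ### A Phragmén–Lindelöf argument. -/

section PL

/-- Exponential type has order 1, below the critical order 2 of a quadrant. Boundedness on the two
diagonals therefore gives boundedness everywhere, Liouville makes `f` constant, and decay along the
imaginary axis makes it zero. -/
theorem eq_zero_of_exp_type {E : Type*} [NormedAddCommGroup E] [NormedSpace ℂ E] {f : ℂ → E}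
    (hf : Differentiable ℂ f) {K b : ℝ} (hexp : ∀ z, ‖f z‖ ≤ K * Real.exp (b * ‖z‖)) {C R : ℝ}
    (hray : ∀ z : ℂ, R ≤ ‖z‖ → ‖z‖ ≤ 2 * |z.im| → ‖f z‖ ≤ C / ‖z‖) (z : ℂ) : f z = 0 := by
  -- Multiplication by `ω` takes the coordinate axes to the diagonals, which lie in the sector
  -- because `√2 ≤ 2`.
  set ω : ℂ := 1 + Complex.I with hω
  have hω0 : ω ≠ 0 := fun h => by simpa [hω] using congrArg Complex.re h
  have haxis : ∃ M, ∀ x : ℝ, ‖f (ω * x)‖ ≤ M ∧ ‖f (ω * (x * Complex.I))‖ ≤ M := by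
    obtain ⟨M₁, hM₁⟩ := (isCompact_closedBall (0 : ℂ) (|R| + 1)).exists_bound_of_continuousOn
      hf.continuous.continuousOn
    refine ⟨max M₁ |C|, fun x => ?_⟩
    have key : ∀ w : ℂ, ‖w‖ ≤ 2 * |w.im| → ‖f w‖ ≤ max M₁ |C| := by
      intro w hw
      by_cases hR : ‖w‖ ≤ |R| + 1
      · exact (hM₁ w (by simpa using hR)).trans (le_max_left _ _)
      · push Not at hR
        refine (hray w ((le_abs_self R).trans (by linarith)) hw).trans
          (le_trans ?_ (le_max_right _ _))
        rw [div_le_iff₀ (by linarith [abs_nonneg R])]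
        exact (le_abs_self C).trans (le_mul_of_one_le_right (abs_nonneg C)
          (by linarith [abs_nonneg R]))
    constructor
    · refine key _ ?_
      refine (Complex.norm_le_abs_re_add_abs_im _).trans ?_
      simp [hω]
      linarith
    · refine key _ ?_
      refine (Complex.norm_le_abs_re_add_abs_im _).trans ?_
      simp [hω]
      linarith
  obtain ⟨M, hM⟩ := haxis
  set g : ℂ → E := fun z => f (ω * z) with hg
  have hgd : Differentiable ℂ g := hf.comp (differentiable_id.const_mul ω)
  have hgO : ∀ s : Set ℂ, ∃ c < (2 : ℝ), ∃ B,
      g =O[Bornology.cobounded ℂ ⊓ 𝓟 s] fun z => Real.exp (B * ‖z‖ ^ c) := by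
    refine fun s => ⟨1, by norm_num, b * ‖ω‖, Asymptotics.IsBigO.of_bound K ?_⟩
    refine Eventually.of_forall fun z => (hexp _).trans (le_of_eq ?_)
    rw [Real.rpow_one, Real.norm_of_nonneg (Real.exp_pos _).le, norm_mul, mul_assoc]
  have hbdd : ∀ z, ‖g z‖ ≤ M := by
    intro z
    rcases le_total 0 z.re with h1 | h1 <;> rcases le_total 0 z.im with h2 | h2
    · exact PhragmenLindelof.quadrant_I hgd.diffContOnCl (hgO _) (fun x _ => (hM x).1)
        (fun x _ => (hM x).2) h1 h2
    · exact PhragmenLindelof.quadrant_IV hgd.diffContOnCl (hgO _) (fun x _ => (hM x).1)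
        (fun x _ => (hM x).2) h1 h2
    · exact PhragmenLindelof.quadrant_II hgd.diffContOnCl (hgO _) (fun x _ => (hM x).1)
        (fun x _ => (hM x).2) h1 h2
    · exact PhragmenLindelof.quadrant_III hgd.diffContOnCl (hgO _) (fun x _ => (hM x).1)
        (fun x _ => (hM x).2) h1 h2
  have hfb : ∀ z, ‖f z‖ ≤ M := fun z => by
    have := hbdd (z / ω)
    simp only [hg] at this
    rwa [mul_div_cancel₀ _ hω0] at this
  have hconst : ∀ w, f z = f w := fun w => hf.apply_eq_apply_of_bounded
    ((Metric.isBounded_closedBall (x := (0 : E)) (r := M)).subset (by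
      rintro _ ⟨w, rfl⟩
      simpa using hfb w)) z w
  rw [← norm_le_zero_iff]
  have hlim : Tendsto (fun y : ℝ => C / y) atTop (𝓝 0) := tendsto_const_nhds.div_atTop tendsto_id
  refine ge_of_tendsto hlim ?_
  filter_upwards [eventually_ge_atTop R, eventually_ge_atTop 0] with y hy hy0
  have hn : ‖(y * Complex.I : ℂ)‖ = y := by simp [abs_of_nonneg hy0]
  have := hray (y * Complex.I) (by rw [hn]; exact hy) (by
    rw [hn]; simp [abs_of_nonneg hy0]; linarith)
  rwa [← hconst, hn] at this

end PL
open NormedMatrix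

/-! ### Passing between a function and its almost everywhere derivative. -/

section AeEq

variable {E : Type*} [NormedAddCommGroup E] [NormedSpace ℝ E]

theorem IsPrimitive.ae_eq_zero [CompleteSpace E] {f f' : ℝ → E} (h : IsPrimitive f f') {k : E}
    (hf : ∀ x, 0 ≤ x → f x = k) :
    ∀ᵐ x, 0 < x → f' x = 0 := by
  filter_upwards [h.hasDerivAt_ae] with x hx hx0
  refine (hx hx0).unique ((hasDerivAt_const x k).congr_of_eventuallyEq ?_)
  filter_upwards [Ioi_mem_nhds hx0] with t ht
  exact hf t (le_of_lt ht)

theorem IsPrimitive.eq_zero {f f' : ℝ → E} (h : IsPrimitive f f') (h0 : f 0 = 0)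
    (hf : ∀ᵐ x, 0 < x → f' x = 0) {x : ℝ} (hx : 0 ≤ x) : f x = 0 := by
  rw [(h x hx).2, h0, zero_add]
  refine intervalIntegral.integral_zero_ae ?_
  filter_upwards [hf] with t ht ht'
  rw [uIoc_of_le hx] at ht'
  exact ht ht'.1

theorem eq_of_ae_eq_of_continuousOn {X : Type*} [TopologicalSpace X] [T2Space X] {f g : ℝ → X}
    (hf : ContinuousOn f (Ici 0)) (hg : ContinuousOn g (Ici 0))
    (h : ∀ᵐ x, 0 < x → f x = g x) {x : ℝ} (hx : 0 ≤ x) : f x = g x := by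
  refine Measure.eqOn_of_ae_eq (μ := volume) ?_ hf hg ?_ hx
  · rw [← restrict_Ioi_eq_restrict_Ici]
    exact (ae_restrict_iff' measurableSet_Ioi).2 h
  · rw [interior_Ici, closure_Ioi]

end AeEq

/-! ### The transformation operator between two pencils and the uniqueness theorem. -/

section Transformation

variable {A : Type*} [NormedRing A]

/-- The coefficients of a pencil with values in a Banach algebra. -/
structure PencilData (A : Type*) [NormedRing A] where
  q₀ : ℝ → A
  q₁ : ℝ → A
  h₀ : A
  h₁ : A
  integrable_q₀ : IntegrableOn q₀ (Ioi 0)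
  integrable_q₁ : IntegrableOn q₁ (Ioi 0)
  bounded_q₁ : ∃ B, ∀ x, 0 < x → ‖q₁ x‖ ≤ B

namespace PencilData

variable (d e : PencilData A)

theorem intervalIntegrable_q₀ (x : ℝ) (hx : 0 ≤ x) : IntervalIntegrable d.q₀ volume 0 x := by
  rw [intervalIntegrable_iff_integrableOn_Ioc_of_le hx]
  exact d.integrable_q₀.mono_set Ioc_subset_Ioi_self

theorem intervalIntegrable_q₁ (x : ℝ) (hx : 0 ≤ x) : IntervalIntegrable d.q₁ volume 0 x := by
  rw [intervalIntegrable_iff_integrableOn_Ioc_of_le hx]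
  exact d.integrable_q₁.mono_set Ioc_subset_Ioi_self

variable [NormedAlgebra ℂ A]

/-- The coefficient `2 i ρ q₁ + q₀`. -/
noncomputable def q (d : PencilData A) (ρ : ℂ) (x : ℝ) : A :=
  (2 * Complex.I * ρ) • d.q₁ x + d.q₀ x

/-- The boundary coefficient `i ρ h₁ + h₀`. -/
noncomputable def h (d : PencilData A) (ρ : ℂ) : A := (Complex.I * ρ) • d.h₁ + d.h₀

/-- The pencil with `ρ` replaced by `-ρ`. -/
def reflect (d : PencilData A) : PencilData A where
  q₀ := d.q₀
  q₁ := fun x => -d.q₁ x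
  h₀ := d.h₀
  h₁ := -d.h₁
  integrable_q₀ := d.integrable_q₀
  integrable_q₁ := d.integrable_q₁.neg
  bounded_q₁ := by simpa using d.bounded_q₁

theorem q_reflect (d : PencilData A) (ρ : ℂ) : d.reflect.q (-ρ) = d.q ρ := by
  ext x; simp [q, reflect]

theorem h_reflect (d : PencilData A) (ρ : ℂ) : d.reflect.h (-ρ) = d.h ρ := by
  simp [h, reflect]

end PencilData

variable [NormedAlgebra ℂ A] [CompleteSpace A]

/-- Replacing `c` by `-c` changes the coordinates of the system but not the corner of the
transformation operator. -/
theorem exists_reflected {c : ℂ} {q p : ℝ → A} {P : ℝ → NormedMatrix (Fin 2) A}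
    (hP : IsPrimitive P (fun x => systemMatrix c (q x) * P x - P x * systemMatrix c (p x))) {δ : A}
    (hP0 : P 0 = mk₂ 1 0 δ 1) :
    ∃ P' : ℝ → NormedMatrix (Fin 2) A, P' 0 = mk₂ 1 0 δ 1 ∧
      IsPrimitive P' (fun x => systemMatrix (-c) (q x) * P' x - P' x * systemMatrix (-c) (p x)) ∧
      ∀ x, entry 0 1 (P' x) = entry 0 1 (P x) := by
  -- `U` passes from `(Y, Y' - (c/2) Y)` to `(Y, Y' + (c/2) Y)`, and `V` is its inverse. The first
  -- row of `U` and the last column of `V` are those of the identity, so the upper right corner is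
  -- unchanged.
  set U : NormedMatrix (Fin 2) A := mk₂ 1 0 (c • 1) 1 with hU
  set V : NormedMatrix (Fin 2) A := mk₂ 1 0 (-(c • 1)) 1 with hV
  have hS : ∀ a : A, U * systemMatrix c a = systemMatrix (-c) a * U := fun a => by
    rw [systemMatrix, systemMatrix, hU, mk₂_mul, mk₂_mul]
    congr 1 <;> simp only [mul_one, one_mul, mul_zero, zero_mul, mul_neg, mul_smul_comm,
      zero_add] <;> module
  have hS' : ∀ a : A, systemMatrix c a * V = V * systemMatrix (-c) a := fun a => by
    rw [systemMatrix, systemMatrix, hV, mk₂_mul, mk₂_mul]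
    congr 1 <;> simp only [mul_one, one_mul, mul_zero, zero_mul, mul_neg, mul_smul_comm,
      zero_add] <;> module
  refine ⟨fun x => U * P x * V, ?_, ?_, fun x => ?_⟩
  · change U * P 0 * V = _
    rw [hP0, hU, hV, mk₂_mul, mk₂_mul]
    congr 1 <;> simp
  · refine (((IsPrimitive.const U).mul hP).mul (IsPrimitive.const V)).congr (fun _ _ => rfl)
      (ae_of_all _ fun x _ => ?_)
    have e1 := hS (q x)
    have e2 := hS' (p x)
    simp only [zero_mul, zero_add, mul_zero, add_zero]
    calc _ = systemMatrix (-c) (q x) * U * P x * V - U * P x * (V * systemMatrix (-c) (p x)) := by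
          noncomm_ring
      _ = U * systemMatrix c (q x) * P x * V - U * P x * (systemMatrix c (p x) * V) := by
          rw [e1, e2]
      _ = _ := by noncomm_ring
  · change entry 0 1 (U * P x * V) = _
    conv_lhs => rw [eq_mk₂ (P x), hU, hV, mk₂_mul, mk₂_mul]
    rw [entry_mk₂_zero_one]
    simp

namespace PencilData

variable (d e : PencilData A)

/-- `P` transforms solutions for `e` to solutions for `d`. -/
def IsTransformation (ρ : ℂ) (P : ℝ → NormedMatrix (Fin 2) A) : Prop :=
  P 0 = mk₂ 1 0 (e.h ρ - d.h ρ) 1 ∧ IsPrimitive P (fun x =>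
    systemMatrix (2 * Complex.I * ρ) (d.q ρ x) * P x -
      P x * systemMatrix (2 * Complex.I * ρ) (e.q ρ x))

/-- System and initial value are affine in `ρ`, so the solution is entire, and Grönwall bounds it by
the exponential of an affine function of `|ρ|`. -/
theorem exists_transformation :
    ∃ P : ℂ → ℝ → NormedMatrix (Fin 2) A, (∀ ρ, IsTransformation d e ρ (P ρ)) ∧
      ∀ x, 0 ≤ x → Differentiable ℂ (fun ρ => P ρ x) ∧
        ∃ K b : ℝ, ∀ ρ, ‖P ρ x‖ ≤ K * Real.exp (b * ‖ρ‖) := by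
  set S₀ : PencilData A → ℝ → NormedMatrix (Fin 2) A := fun d t => mk₂ 0 1 (-d.q₀ t) 0
  set S₁ : PencilData A → ℝ → NormedMatrix (Fin 2) A := fun d t =>
    mk₂ (Complex.I • 1) 0 (-((2 * Complex.I) • d.q₁ t)) (-(Complex.I • 1))
  have hS₀ : ∀ d : PencilData A, ∀ x, 0 ≤ x → IntervalIntegrable (S₀ d) volume 0 x :=
    fun d x hx => intervalIntegrable_const.mk₂ intervalIntegrable_const
      (d.intervalIntegrable_q₀ x hx).neg intervalIntegrable_const
  have hS₁ : ∀ d : PencilData A, ∀ x, 0 ≤ x → IntervalIntegrable (S₁ d) volume 0 x :=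
    fun d x hx => intervalIntegrable_const.mk₂ intervalIntegrable_const
      ((d.intervalIntegrable_q₁ x hx).smul (2 * Complex.I)).neg intervalIntegrable_const
  have hS : ∀ (d : PencilData A) (ρ : ℂ) (t : ℝ),
      systemMatrix (2 * Complex.I * ρ) (d.q ρ t) = S₀ d t + ρ • S₁ d t := fun d ρ t => by
    rw [systemMatrix, smul_mk₂, mk₂_add, q]
    congr 1 <;> module
  have V₀ := isVolterra_mulLeft_sub_mulRight (hS₀ d) (hS₀ e)
  have V₁ := isVolterra_mulLeft_sub_mulRight (hS₁ d) (hS₁ e)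
  set c₀ : NormedMatrix (Fin 2) A := mk₂ 1 0 (e.h₀ - d.h₀) 1
  set c₁ : NormedMatrix (Fin 2) A := mk₂ 0 0 (Complex.I • (e.h₁ - d.h₁)) 0
  choose P hP0 hP using fun ρ : ℂ =>
    (V₀.add_smul V₁ (le_refl ‖ρ‖)).exists_solution (c₀ + ρ • c₁)
  refine ⟨P, fun ρ => ⟨?_, ?_⟩, fun x hx => ⟨V₀.differentiable_solution V₁ hP0 hP hx, ?_⟩⟩
  · rw [hP0, smul_mk₂, mk₂_add, h, h]
    congr 1
    · simp
    · simp
    · module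
    · simp
  · refine (hP ρ).congr (fun _ _ => rfl) (ae_of_all _ fun x _ => ?_)
    simp only [hS, LinearMap.add_apply, LinearMap.smul_apply, LinearMap.sub_apply,
      LinearMap.mulLeft_apply, LinearMap.mulRight_apply]
    rw [add_mul, mul_add, smul_mul_assoc, mul_smul_comm, smul_sub]
    abel
  · set I₀ := ∫ t in 0..x, (‖S₀ d t‖ + ‖S₀ e t‖)
    set I₁ := ∫ t in 0..x, (‖S₁ d t‖ + ‖S₁ e t‖)
    refine ⟨(‖c₀‖ + ‖c₁‖) * Real.exp I₀, 1 + I₁, fun ρ => ?_⟩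
    have h := (V₀.add_smul V₁ (le_refl ‖ρ‖)).norm_le_of_homogeneous (hP ρ) hx
    rw [intervalIntegral.integral_add (V₀.integrable x hx) ((V₁.integrable x hx).const_mul _),
      intervalIntegral.integral_const_mul, hP0] at h
    have h1 : ‖c₀ + ρ • c₁‖ ≤ (‖c₀‖ + ‖c₁‖) * Real.exp ‖ρ‖ := by
      have e1 : 1 ≤ Real.exp ‖ρ‖ := Real.one_le_exp (norm_nonneg _)
      have e2 : ‖ρ‖ ≤ Real.exp ‖ρ‖ := by linarith [Real.add_one_le_exp ‖ρ‖]
      calc _ ≤ ‖c₀‖ + ‖ρ‖ * ‖c₁‖ := (norm_add_le _ _).trans (by rw [norm_smul])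
        _ ≤ ‖c₀‖ * Real.exp ‖ρ‖ + Real.exp ‖ρ‖ * ‖c₁‖ := by
            gcongr
            exact le_mul_of_one_le_right (norm_nonneg _) e1
        _ = _ := by ring
    calc ‖P ρ x‖ ≤ ((‖c₀‖ + ‖c₁‖) * Real.exp ‖ρ‖) * Real.exp (I₀ + ‖ρ‖ * I₁) :=
          h.trans (mul_le_mul_of_nonneg_right h1 (Real.exp_pos _).le)
      _ = (‖c₀‖ + ‖c₁‖) * Real.exp I₀ * Real.exp ((1 + I₁) * ‖ρ‖) := by
          rw [mul_assoc, mul_assoc, ← Real.exp_add, ← Real.exp_add]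
          ring_nf

variable {d e}

theorem IsTransformation.reflect {ρ : ℂ} {P : ℝ → NormedMatrix (Fin 2) A}
    (hP : IsTransformation d e ρ P) :
    ∃ P', IsTransformation d.reflect e.reflect (-ρ) P' ∧
      ∀ x, entry 0 1 (P' x) = entry 0 1 (P x) := by
  obtain ⟨P', h0, hP', hx⟩ := exists_reflected hP.2 hP.1
  refine ⟨P', ⟨?_, ?_⟩, hx⟩
  · rw [h0, h_reflect, h_reflect]
  · rw [q_reflect, q_reflect, mul_neg]
    exact hP'

/-- Write `α, γ, δ` for the other blocks. The corner's equation gives `δ = α`; then `α' = γ` and `δ'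
= -γ` give `γ = 0` and `α = 1`. Now `P = 1`, and what remains of the equation for `γ` is equality of
the potentials, while `γ(0) = 0` is equality of the boundary coefficients. -/
theorem IsTransformation.eq_of_corner_eq_zero {ρ : ℂ} {P : ℝ → NormedMatrix (Fin 2) A}
    (hP : IsTransformation d e ρ P) (h : ∀ x, 0 ≤ x → entry 0 1 (P x) = 0) :
    d.h ρ = e.h ρ ∧ ∀ᵐ x, 0 < x → d.q ρ x = e.q ρ x := by
  set α := fun x => entry 0 0 (P x) with hα
  set γ := fun x => entry 1 0 (P x) with hγ
  set δ := fun x => entry 1 1 (P x) with hδ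
  have hE : ∀ i j, IsPrimitive (fun x => entry i j (P x)) (fun x => entry i j
      (systemMatrix (2 * Complex.I * ρ) (d.q ρ x) * P x -
        P x * systemMatrix (2 * Complex.I * ρ) (e.q ρ x))) := fun i j => hP.2.clmComplex (entry i j)
  have hS : ∀ᵐ x : ℝ, 0 < x → (systemMatrix (2 * Complex.I * ρ) (d.q ρ x) * P x -
        P x * systemMatrix (2 * Complex.I * ρ) (e.q ρ x)) =
      mk₂ (γ x) (δ x - α x) (-(d.q ρ x * α x) + δ x * e.q ρ x -
        (2 * Complex.I * ρ) • γ x) (-γ x) := ae_of_all _ fun x hx => by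
    rw [eq_mk₂ (P x), h x hx.le, systemMatrix, systemMatrix, mk₂_mul, mk₂_mul, mk₂_sub]
    congr 1 <;> simp only [mul_one, one_mul, mul_zero, zero_mul, smul_mul_assoc, neg_mul, mul_neg,
      mul_smul_comm, zero_add, hα, hγ, hδ] <;> module
  have h0 := hP.1
  have hα0 : α 0 = 1 := by rw [hα]; simp only [h0]; rfl
  have hγ0 : γ 0 = e.h ρ - d.h ρ := by rw [hγ]; simp only [h0]; rfl
  have hδ0 : δ 0 = 1 := by rw [hδ]; simp only [h0]; rfl
  have hαP : IsPrimitive α γ := (hE 0 0).congr (fun _ _ => rfl) (by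
    filter_upwards [hS] with x hx h; rw [hx h]; rfl)
  have hβP : IsPrimitive (fun x => entry 0 1 (P x)) (fun x => δ x - α x) :=
    (hE 0 1).congr (fun _ _ => rfl) (by filter_upwards [hS] with x hx h; rw [hx h]; rfl)
  have hδP : IsPrimitive δ (fun x => -γ x) := (hE 1 1).congr (fun _ _ => rfl) (by
    filter_upwards [hS] with x hx h; rw [hx h]; rfl)
  have hγP : IsPrimitive γ (fun x => -(d.q ρ x * α x) + δ x * e.q ρ x -
      (2 * Complex.I * ρ) • γ x) := (hE 1 0).congr (fun _ _ => rfl) (by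
    filter_upwards [hS] with x hx h
    rw [hx h]
    rfl)
  have hδα : ∀ x, 0 ≤ x → δ x = α x := fun x hx =>
    eq_of_ae_eq_of_continuousOn hδP.continuousOn hαP.continuousOn (by
      filter_upwards [hβP.ae_eq_zero h] with x hx h
      exact sub_eq_zero.1 (hx h)) hx
  have hγz : ∀ x, 0 ≤ x → γ x = 0 := fun x hx =>
    eq_of_ae_eq_of_continuousOn (g := fun _ => (0 : A)) hγP.continuousOn continuousOn_const (by
      filter_upwards [(hδP.sub hαP).ae_eq_zero (k := 0) fun x hx => sub_eq_zero.2 (hδα x hx)]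
        with x hx h
      have e1 : (2 : ℂ) • γ x = 0 := by
        rw [two_smul, ← neg_eq_zero, neg_add']
        exact hx h
      exact (smul_eq_zero.1 e1).resolve_left two_ne_zero) hx
  have hα1 : ∀ x, 0 ≤ x → α x = 1 := fun x hx => sub_eq_zero.1 <|
    (hαP.sub (IsPrimitive.const 1)).eq_zero (by rw [hα0, sub_self])
      (ae_of_all _ fun x hx => by rw [hγz x hx.le, sub_zero]) hx
  refine ⟨(sub_eq_zero.1 (hγ0.symm.trans (hγz 0 le_rfl))).symm, ?_⟩
  filter_upwards [hγP.ae_eq_zero hγz] with x hx h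
  have := hx h
  rw [hδα x h.le, hα1 x h.le, hγz x h.le, smul_zero, mul_one, one_mul, sub_zero,
    neg_add_eq_zero] at this
  exact this

variable [NormOneClass A]

/-- In a sector of the upper half-plane equality of the Weyl functions makes the corner of the
transformation operator small. -/
theorem corner_le (hd : IsUnit (1 + d.h₁)) (he : IsUnit (1 + e.h₁)) {x : ℝ} (hx : 0 ≤ x) :
    ∃ R C : ℝ, ∀ ρ : ℂ, R ≤ ‖ρ‖ → ‖ρ‖ ≤ 2 * ρ.im →
      (∀ a b, IsWeylValue (2 * Complex.I * ρ) (d.q ρ) (d.h ρ) a →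
        IsWeylValue (2 * Complex.I * ρ) (e.q ρ) (e.h ρ) b → a = b) →
      ∀ P, IsTransformation d e ρ P → ‖entry 0 1 (P x)‖ ≤ C / ‖ρ‖ := by
  obtain ⟨B, hB⟩ := d.bounded_q₁
  obtain ⟨B', hB'⟩ := e.bounded_q₁
  obtain ⟨R, hR1, hR⟩ := exists_riccati_isUnit d.integrable_q₀ d.integrable_q₁ hB hd d.h₀
  obtain ⟨R', hR1', hR'⟩ := exists_riccati_isUnit e.integrable_q₀ e.integrable_q₁ hB' he e.h₀
  -- `D` and `S` bound the boundary data and the potentials divided by `c`. They are independent of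
  -- `ρ` because `‖c⁻¹‖ ≤ 1`.
  set D := ‖e.h₁ - d.h₁‖ + ‖e.h₀ - d.h₀‖ with hD
  set S := ∫ t in 0..x, ((‖d.q₁ t‖ + ‖d.q₀ t‖) + (‖e.q₁ t‖ + ‖e.q₀ t‖)) with hS
  refine ⟨max R R', 8 * (1 + 2 * D) * (1 + S) * Real.exp (4 * S), fun ρ hρ hs hW P hP => ?_⟩
  have hρR := (le_max_left _ _).trans hρ
  have hρR' := (le_max_right _ _).trans hρ
  have hρ1 : 1 ≤ ‖ρ‖ := hR1.trans hρR
  have hρne : ρ ≠ 0 := norm_pos_iff.1 (by linarith)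
  obtain ⟨κ, hκ1, hκ, hκu⟩ := hR ρ hρR hs
  obtain ⟨μ, hμ1, hμ, hμu⟩ := hR' ρ hρR' hs
  set c := 2 * Complex.I * ρ with hc
  have hc0 : c ≠ 0 := by simp [hc, hρne]
  have hcn : ‖c⁻¹‖ ≤ ‖ρ‖⁻¹ := by
    rw [norm_inv, hc, norm_mul, norm_mul, Complex.norm_I, Complex.norm_ofNat]
    exact inv_anti₀ (by linarith) (by linarith)
  have hcn1 : ‖c⁻¹‖ ≤ 1 := hcn.trans (inv_le_one_of_one_le₀ hρ1)
  have hqd : ∀ f : PencilData A, (fun x => c • (f.q₁ x + c⁻¹ • f.q₀ x)) = f.q ρ := fun f => by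
    ext x
    rw [smul_add, smul_inv_smul₀ hc0]; rfl
  have hint : ∀ f : PencilData A, IntegrableOn (fun x => f.q₁ x + c⁻¹ • f.q₀ x) (Ioi 0) :=
    fun f => f.integrable_q₁.add (Integrable.smul c⁻¹ f.integrable_q₀)
  have hinti : ∀ f : PencilData A, ∀ x, 0 ≤ x →
      IntervalIntegrable (fun x => f.q₁ x + c⁻¹ • f.q₀ x) volume 0 x := fun f x hx =>
    (f.intervalIntegrable_q₁ x hx).add ((f.intervalIntegrable_q₀ x hx).smul c⁻¹)
  have hle : ∀ (f : PencilData A) t, ‖f.q₁ t + c⁻¹ • f.q₀ t‖ ≤ ‖f.q₁ t‖ + ‖f.q₀ t‖ := fun f t =>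
    (norm_add_le _ _).trans (by
      rw [norm_smul]
      exact add_le_add le_rfl (mul_le_of_le_one_left (norm_nonneg _) hcn1))
  obtain ⟨C, hC, -⟩ := isUnit_iff_exists.1 hκu
  obtain ⟨C', hC', hC''⟩ := isUnit_iff_exists.1 hμu
  have hw := exists_decaying_solution (hint d) hκ hκ1 hC
  have hw' := exists_decaying_solution (hint e) hμ hμ1 hC'
  rw [hqd] at hw hw'
  have htri := triangular_initial hc0 hC hC' hC'' (hW _ _ hw hw')
  have hPP := hP.2
  rw [← hqd d, ← hqd e] at hPP
  refine (norm_entry_zero_one_le hc0 (by simp [hc]; linarith) (hinti d) (hinti e) hκ hμ hκ1 hμ1 hPP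
    hP.1 (D := D) (S := S) ?_ htri hx ?_).trans ?_
  · have e1 : c⁻¹ • (e.h ρ - d.h ρ) =
        (2 : ℂ)⁻¹ • (e.h₁ - d.h₁) + c⁻¹ • (e.h₀ - d.h₀) := by
      rw [h, h]
      have : (2 : ℂ)⁻¹ = c⁻¹ * (Complex.I * ρ) := by
        rw [hc]; field_simp
      rw [this]
      module
    rw [e1]
    refine (norm_add_le _ _).trans (add_le_add ?_ ?_) <;> rw [norm_smul]
    · exact mul_le_of_le_one_left (norm_nonneg _) (by norm_num)
    · exact mul_le_of_le_one_left (norm_nonneg _) hcn1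
  · refine intervalIntegral.integral_mono_on hx ((hinti d x hx).norm.add (hinti e x hx).norm) ?_
      fun t _ => add_le_add (hle d t) (hle e t)
    exact ((d.intervalIntegrable_q₁ x hx).norm.add (d.intervalIntegrable_q₀ x hx).norm).add
      ((e.intervalIntegrable_q₁ x hx).norm.add (e.intervalIntegrable_q₀ x hx).norm)
  · have hS0 : 0 ≤ S := intervalIntegral.integral_nonneg hx fun t _ => by positivity
    rw [div_eq_inv_mul]
    gcongr

/-- The Weyl functions of `d` and `e` agree where both are defined. -/
def WeylEq (d e : PencilData A) : Prop :=
  ∀ ρ : ℂ, 0 < ρ.im → ∀ a b, IsWeylValue (2 * Complex.I * ρ) (d.q ρ) (d.h ρ) a →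
    IsWeylValue (2 * Complex.I * ρ) (e.q ρ) (e.h ρ) b → a = b

theorem corner_eq_zero (hd : IsUnit (1 + d.h₁)) (he : IsUnit (1 + e.h₁))
    (hd' : IsUnit (1 - d.h₁)) (he' : IsUnit (1 - e.h₁)) (hW : WeylEq d e)
    (hW' : WeylEq d.reflect e.reflect) {P : ℂ → ℝ → NormedMatrix (Fin 2) A}
    (hP : ∀ ρ, IsTransformation d e ρ (P ρ)) {x : ℝ} (hx : 0 ≤ x)
    (hdiff : Differentiable ℂ (fun ρ => P ρ x)) {K b : ℝ}
    (hexp : ∀ ρ, ‖P ρ x‖ ≤ K * Real.exp (b * ‖ρ‖)) (ρ : ℂ) : entry 0 1 (P ρ x) = 0 := by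
  obtain ⟨R, C, h⟩ := corner_le hd he hx
  obtain ⟨R', C', h'⟩ := corner_le (d := d.reflect) (e := e.reflect)
    (by rwa [reflect, ← sub_eq_add_neg]) (by rwa [reflect, ← sub_eq_add_neg]) hx
  refine eq_zero_of_exp_type (f := fun ρ => entry 0 1 (P ρ x)) (C := max C C')
    (R := max 1 (max R R')) ((entry (n := Fin 2) (A := A) 0 1).differentiable.comp hdiff)
    (fun ρ => (norm_entry_le (P ρ x) 0 1).trans (hexp ρ)) (fun ρ hR hs => ?_) ρ
  -- The `1` in the radius excludes `ρ = 0`, so the sector condition puts `ρ` strictly inside a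
  -- half-plane.
  have hρ : 0 < ‖ρ‖ := one_pos.trans_le ((le_max_left _ _).trans hR)
  have hR1 : max R R' ≤ ‖ρ‖ := (le_max_right _ _).trans hR
  rcases le_total 0 ρ.im with h0 | h0
  · rw [abs_of_nonneg h0] at hs
    refine (h ρ ((le_max_left _ _).trans hR1) hs (hW ρ (by linarith)) _ (hP ρ)).trans ?_
    gcongr
    exact le_max_left _ _
  · rw [abs_of_nonpos h0] at hs
    obtain ⟨P', hP', hx'⟩ := (hP ρ).reflect
    have := h' (-ρ) (by rw [norm_neg]; exact (le_max_right _ _).trans hR1)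
      (by rwa [norm_neg, Complex.neg_im]) (hW' (-ρ) (by rw [Complex.neg_im]; linarith)) _ hP'
    rw [hx', norm_neg] at this
    refine this.trans ?_
    gcongr
    exact le_max_right _ _

theorem eq_of_weylEq (hd : IsUnit (1 + d.h₁)) (he : IsUnit (1 + e.h₁))
    (hd' : IsUnit (1 - d.h₁)) (he' : IsUnit (1 - e.h₁)) (hW : WeylEq d e)
    (hW' : WeylEq d.reflect e.reflect) :
    d.h₀ = e.h₀ ∧ d.h₁ = e.h₁ ∧ (∀ᵐ x, 0 < x → d.q₀ x = e.q₀ x) ∧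
      ∀ᵐ x, 0 < x → d.q₁ x = e.q₁ x := by
  obtain ⟨P, hP, hPx⟩ := exists_transformation d e
  have key : ∀ ρ, d.h ρ = e.h ρ ∧ ∀ᵐ x, 0 < x → d.q ρ x = e.q ρ x := fun ρ =>
    (hP ρ).eq_of_corner_eq_zero fun x hx => by
      obtain ⟨hdiff, K, b, hexp⟩ := hPx x hx
      exact corner_eq_zero hd he hd' he' hW hW' hP hx hdiff hexp ρ
  obtain ⟨h0, q0⟩ := key 0
  -- Two values of `ρ` separate the coefficients: `ρ = 0` isolates those of index 0, and this one
  -- makes `2iρ = 1`.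
  obtain ⟨h1, q1⟩ := key (-Complex.I / 2)
  simp only [h, q, mul_zero, zero_smul, zero_add] at h0 q0
  have e1 : Complex.I * (-Complex.I / 2) = 1 / 2 := by
    linear_combination (-1 / 2 : ℂ) * Complex.I_mul_I
  have e2 : 2 * Complex.I * (-Complex.I / 2) = 1 := by rw [mul_assoc, e1]; norm_num
  simp only [h, q, e1, e2, one_smul] at h1 q1
  refine ⟨h0, ?_, q0, ?_⟩
  · rw [h0, add_left_inj] at h1
    exact smul_right_injective A (by norm_num : (1 / 2 : ℂ) ≠ 0) h1
  · filter_upwards [q0, q1] with x h0 h1 hx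
    have := h1 hx
    rwa [h0 hx, add_left_inj] at this

end PencilData

end Transformation
open NormedMatrix

/-! ### From coefficients given entrywise to the Banach algebra setting. -/

section HalfLine

variable {E : Type*} [NormedAddCommGroup E] [NormedSpace ℝ E] [CompleteSpace E]

theorem IsPrimitive.hasDerivWithinAt {f f' : ℝ → E} (hf : IsPrimitive f f')
    (hc : ContinuousOn f' (Ici 0)) {x : ℝ} (hx : 0 ≤ x) : HasDerivWithinAt f (f' x) (Ici 0) x := by
  -- Extending `f'` by its value at `0` makes it continuous on the line, which covers the one-sided
  -- derivative at the endpoint.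
  have hg : Continuous fun t : ℝ => f' (max t 0) :=
    hc.comp_continuous (by fun_prop) fun t => le_max_right t 0
  have h := ((hg.integral_hasStrictDerivAt 0 x).hasDerivAt.const_add (f 0)).hasDerivWithinAt
    (s := Ici 0)
  rw [max_eq_left hx] at h
  have key : ∀ y ∈ Ici (0 : ℝ), f y = f 0 + ∫ t in 0..y, f' (max t 0) := fun y hy => by
    rw [(hf y hy).2]
    congr 1
    refine intervalIntegral.integral_congr fun t ht => ?_
    rw [uIcc_of_le hy] at ht
    simp only [max_eq_left ht.1]
  exact h.congr key (key x hx)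

/-- Serves to bound `Q₁`; integrability of `Q₁'` enters the argument only through this bound. -/
theorem exists_norm_le_of_integrableOn_deriv [FiniteDimensional ℝ E] {f : ℝ → E}
    (hf : ∀ T, 0 < T → AbsolutelyContinuousOnInterval f 0 T)
    (hi : IntegrableOn (deriv f) (Ioi 0)) : ∃ B, ∀ x, 0 < x → ‖f x‖ ≤ B := by
  refine ⟨‖f 0‖ + ∫ t in Ioi 0, ‖deriv f t‖, fun x hx => ?_⟩
  have hd : ∀ᵐ t, t ∈ uIcc 0 x → HasDerivAt f (deriv f t) t := by
    filter_upwards [(hf x hx).boundedVariationOn.ae_differentiableAt_of_mem_uIcc] with t ht h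
    exact (ht h).hasDerivAt
  have h := (hf x hx).sub_eq_integral hd
    ((intervalIntegrable_iff_integrableOn_Ioc_of_le hx.le).2 (hi.mono_set Ioc_subset_Ioi_self))
  rw [sub_eq_iff_eq_add'] at h
  rw [h]
  refine (norm_add_le _ _).trans (add_le_add le_rfl ?_)
  refine (intervalIntegral.norm_integral_le_integral_norm hx.le).trans ?_
  rw [intervalIntegral.integral_of_le hx.le]
  exact setIntegral_mono_set hi.norm (ae_of_all _ fun _ => norm_nonneg _)
    Ioc_subset_Ioi_self.eventuallyLE

end HalfLine

namespace NormedMatrix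

variable {n : Type*} [Fintype n] [DecidableEq n]

instance [Nonempty n] : NormOneClass (NormedMatrix n ℂ) := Matrix.linfty_opNormOneClass

theorem eq_sum_single (X : NormedMatrix n ℂ) : X = ∑ i, ∑ j, single i j (entry i j X) :=
  Matrix.matrix_eq_sum_single (X : Matrix n n ℂ)

theorem integrableOn_of_entry {F : ℝ → NormedMatrix n ℂ} {s : Set ℝ}
    (h : ∀ i j, IntegrableOn (fun x => entry i j (F x)) s) : IntegrableOn F s := by
  have e : F = fun x => ∑ i, ∑ j, single i j (entry i j (F x)) :=
    funext fun x => eq_sum_single (F x)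
  rw [e]
  exact integrable_finsetSum _ fun i _ => integrable_finsetSum _ fun j _ =>
    (single i j).integrable_comp (h i j)

theorem exists_norm_le_of_entry {F : ℝ → NormedMatrix n ℂ}
    (h : ∀ i j, ∃ B, ∀ x, 0 < x → ‖entry i j (F x)‖ ≤ B) : ∃ B, ∀ x, 0 < x → ‖F x‖ ≤ B := by
  choose B hB using h
  refine ⟨∑ i, ∑ j, B i j, fun x hx => ?_⟩
  rw [eq_sum_single (F x)]
  refine (norm_sum_le _ _).trans (Finset.sum_le_sum fun i _ => (norm_sum_le _ _).trans
    (Finset.sum_le_sum fun j _ => ?_))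
  exact (norm_single_le i j _).trans (hB i j x hx)

theorem isUnit_of_det_ne_zero {X : NormedMatrix n ℂ} (h : Matrix.det (X : Matrix n n ℂ) ≠ 0) :
    IsUnit X :=
  (Matrix.isUnit_iff_isUnit_det (X : Matrix n n ℂ)).2 (isUnit_iff_ne_zero.2 h)

end NormedMatrix

/-! ### Translation to quadratic pencils and conclusion. -/

namespace QuadraticPencil

variable {m : ℕ} {L : QuadraticPencil m}

/-- The coefficients as functions with values in a Banach algebra of matrices. -/
def InClassV.pencilData (hL : L.InClassV) : PencilData (NormedMatrix (Fin m) ℂ) where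
  q₀ := L.Q₀
  q₁ := L.Q₁
  h₀ := L.h₀
  h₁ := L.h₁
  integrable_q₀ := integrableOn_of_entry hL.integrable_Q₀
  integrable_q₁ := integrableOn_of_entry hL.integrable_Q₁
  bounded_q₁ := exists_norm_le_of_entry fun i j => exists_norm_le_of_integrableOn_deriv
    (fun T hT => hL.absCont_Q₁ T hT i j) (hL.integrable_deriv_Q₁ i j)

/-- Both half-planes are treated together: `c / 2 = ± iρ` has square `-ρ²` for either sign, and the
sign selects the decaying exponential. -/
theorem InClassV.isWeylMatrixAt (hL : L.InClassV) {ρ c : ℂ}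
    (hc : 0 < ρ.im ∧ c = 2 * Complex.I * ρ ∨ ρ.im < 0 ∧ c = -(2 * Complex.I * ρ))
    {a : NormedMatrix (Fin m) ℂ}
    (ha : IsWeylValue c (hL.pencilData.q ρ) (hL.pencilData.h ρ) a) : L.IsWeylMatrixAt ρ a := by
  obtain ⟨Y, V, hY, hV, h0, ⟨K, hK⟩, rfl⟩ := ha
  have hc2 : (c / 2) ^ 2 = -ρ ^ 2 := by
    have : (c / 2) ^ 2 = (Complex.I * ρ) ^ 2 := by
      rcases hc with ⟨-, rfl⟩ | ⟨-, rfl⟩ <;> ring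
    rw [this, mul_pow, Complex.I_sq, neg_one_mul]
  have hgrowth : ∀ z : ℂ, c / 2 = z → ∀ j k,
      (fun x : ℝ => (Y x : Matrix (Fin m) (Fin m) ℂ) j k) =O[atTop]
        fun x : ℝ => Complex.exp (z * x) := by
    rintro _ rfl j k
    refine Asymptotics.IsBigO.of_bound K ?_
    filter_upwards [eventually_ge_atTop 0] with x hx
    exact (norm_entry_le (Y x) j k).trans (hK x hx)
  refine ⟨Y, V, ⟨?_, ⟨fun x hx j k => ?_, fun T hT j k => ?_, ?_⟩, h0, fun h j k => ?_,
    fun h j k => ?_⟩, rfl⟩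
  · rcases hc with ⟨h, -⟩ | ⟨h, -⟩
    exacts [h.ne', h.ne]
  · exact (hY.clmComplex (entry j k)).hasDerivWithinAt
      ((entry (n := Fin m) (A := ℂ) j k).continuous.comp_continuousOn hV.continuousOn) hx
  · exact (hV.clmComplex (entry j k)).absolutelyContinuous hT.le
  · rw [ae_restrict_iff' measurableSet_Ioi]
    have : ∀ᵐ x : ℝ, ∀ j k, 0 < x → HasDerivAt (fun t => entry j k (V t)) (entry j k
        ((c / 2) ^ 2 • Y x - hL.pencilData.q ρ x * Y x)) x := by
      simp only [ae_all_iff]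
      exact fun j k => (hV.clmComplex (entry j k)).hasDerivAt_ae
    filter_upwards [this] with x hx h0 j k
    have e : ∀ X : NormedMatrix (Fin m) ℂ,
        X = ρ ^ 2 • (1 : NormedMatrix (Fin m) ℂ) + hL.pencilData.q ρ x →
        ((c / 2) ^ 2 • Y x - hL.pencilData.q ρ x * Y x) = -(X * Y x) := by
      rintro X rfl
      rw [hc2, add_mul, smul_mul_assoc, one_mul]
      module
    have h := hx j k h0
    rw [e (L.coeff ρ x) (add_assoc _ _ _)] at h
    exact h
  · rcases hc with ⟨-, rfl⟩ | ⟨h', -⟩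
    · exact hgrowth _ (by ring) j k
    · exact absurd h h'.not_gt
  · rcases hc with ⟨h', -⟩ | ⟨-, rfl⟩
    · exact absurd h h'.not_gt
    · simpa only [neg_mul] using hgrowth (-(Complex.I * ρ)) (by ring) j k

theorem InClassV.weylEq {L' : QuadraticPencil m} (hL : L.InClassV) (hL' : L'.InClassV)
    (hM : ∀ (ρ : ℂ) (A A' : Matrix (Fin m) (Fin m) ℂ),
      L.IsWeylMatrixAt ρ A → L'.IsWeylMatrixAt ρ A' → A = A') :
    PencilData.WeylEq hL.pencilData hL'.pencilData ∧
      PencilData.WeylEq hL.pencilData.reflect hL'.pencilData.reflect := by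
  refine ⟨fun ρ hρ a b ha hb => hM ρ a b (hL.isWeylMatrixAt (.inl ⟨hρ, rfl⟩) ha)
    (hL'.isWeylMatrixAt (.inl ⟨hρ, rfl⟩) hb), fun ρ hρ a b ha hb => ?_⟩
  obtain ⟨σ, rfl⟩ : ∃ σ, ρ = -σ := ⟨-ρ, (neg_neg ρ).symm⟩
  rw [Complex.neg_im, neg_pos] at hρ
  rw [PencilData.q_reflect, PencilData.h_reflect] at ha hb
  exact hM σ a b (hL.isWeylMatrixAt (.inr ⟨hρ, mul_neg _ _⟩) ha)
    (hL'.isWeylMatrixAt (.inr ⟨hρ, mul_neg _ _⟩) hb)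

end QuadraticPencil

/-- If the Weyl matrices of two pencils of class `𝒱` with `det (I ± h₁) ≠ 0` agree at every
non-real `ρ` where both are defined, the pencils coincide: `Q₁` on `[0, ∞)`, `Q₀` as an
element of `L¹(0, ∞)`, and the matrices `h₀`, `h₁`. -/
theorem mainTheorem1 (m : ℕ) (L L' : QuadraticPencil m)
    (hL : L.InClassV) (hL' : L'.InClassV)
    (hplus : (1 + L.h₁).det ≠ 0) (hminus : (1 - L.h₁).det ≠ 0)
    (hplus' : (1 + L'.h₁).det ≠ 0) (hminus' : (1 - L'.h₁).det ≠ 0)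
    (hM : ∀ (ρ : ℂ) (A A' : Matrix (Fin m) (Fin m) ℂ),
      L.IsWeylMatrixAt ρ A → L'.IsWeylMatrixAt ρ A' → A = A') :
    (∀ x : ℝ, 0 ≤ x → L.Q₁ x = L'.Q₁ x) ∧
      (∀ᵐ x ∂(volume.restrict (Set.Ioi (0 : ℝ))), L.Q₀ x = L'.Q₀ x) ∧
      L.h₀ = L'.h₀ ∧ L.h₁ = L'.h₁ := by
  -- For `m = 0` the unit matrix has norm 0, so the normed algebra argument, which needs `‖1‖ = 1`,
  -- does not apply.
  rcases isEmpty_or_nonempty (Fin m) with _ | _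
  · exact ⟨fun _ _ => Subsingleton.elim _ _, ae_of_all _ fun _ => Subsingleton.elim _ _,
      Subsingleton.elim _ _, Subsingleton.elim _ _⟩
  obtain ⟨hW, hW'⟩ := hL.weylEq hL' hM
  obtain ⟨h0, h1, q0, q1⟩ := PencilData.eq_of_weylEq (isUnit_of_det_ne_zero hplus)
    (isUnit_of_det_ne_zero hplus') (isUnit_of_det_ne_zero hminus)
    (isUnit_of_det_ne_zero hminus') hW hW'
  refine ⟨fun x hx => ?_, (ae_restrict_iff' measurableSet_Ioi).2 q0, h0, h1⟩
  ext j k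
  -- Absolute continuity makes the entries of `Q₁` continuous up to `0`, which upgrades equality
  -- almost everywhere to equality at every point.
  refine eq_of_ae_eq_of_continuousOn
    (continuousOn_Ici_of_absolutelyContinuousOnInterval fun T hT => hL.absCont_Q₁ T hT j k)
    (continuousOn_Ici_of_absolutelyContinuousOnInterval fun T hT => hL'.absCont_Q₁ T hT j k) ?_ hx
  filter_upwards [q1] with t ht h
  exact congrFun (congrFun (ht h) j) k
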